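/- Let $X$ and $H$ be real Hilbert spaces, $f, g_1,\dots,g_m : X \to \mathbb{R}$ and $F : X \to H$ continuously Fréchet differentiable, and consider the problem $$(\mathcal P)\qquad \min f(x)\quad\text{subject to}\quad F(x)=0,\quad g_i(x)\le 0,\ i=1,\dots,m .$$ Assume that $(\mathcal P)$ has a globally optimal solution, and let $f_*$ be its optimal value. Write $g=(g_1,\dots,g_m)$, let $|\cdot|$ be the Euclidean norm, let $\max$ of vectors be taken coordinatewise, and put $\nabla g(x)y = (\langle\nabla g_i(x),y\rangle)_{i}$. Let $\phi:[0,\infty)\to[0,\infty]$ be convex, non-decreasing and lower semicontinuous, with $\phi(t)=0$ if and only if $t=0$, and $\operatorname{dom}\phi=\{t : \phi(t)<\infty\}\neq\{0\}$. Let $\psi:[0,\infty)^m\to\mathbb{R}$ be continuously differentiable and concave, with $\psi(0)>0$, with a global maximum at $0$, and with $\frac{\partial\psi}{\partial y_i}(y)=0$ for all $y\in[0,\infty)^m$ with $y_i=0$, $i=1,\dots,m$. For $x \in X$, $\mu\in\mathbb{R}^m$ put $$b(x)=\psi(\max\{g(x),0\}),\qquad p(x,\mu)=\frac{b(x)}{1+|\mu|^2},\qquad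 \Omega=\{x\in X : b(x)>0,\ \phi(\|F(x)\|^2)<\infty\}.$$ Let $L(x,\lambda,\mu)=f(x)+\langle\lambda,F(x)\rangle+\langle\mu,g(x)\rangle$ for $\lambda\in H$, $\mu\in\mathbb{R}^m$, and $$\eta(x,\lambda,\mu)=\tfrac12\big\|DF(x)[\nabla_xL(x,\lambda,\mu)]\big\|^2+\tfrac12\sum_{i=1}^m\Big(\langle\nabla g_i(x),\nabla_xL(x,\lambda,\mu)\rangle+g_i(x)^2\mu_i\Big)^2 .$$ For $c>0$ define the augmented Lagrangian by $$\mathscr L(x,\lambda,\mu,c)=f(x)+\langle\lambda,F(x)\rangle+\tfrac c2(1+\|\lambda\|^2)\phi(\|F(x)\|^2)+\langle\mu,q\rangle+\frac{c}{2p(x,\mu)}|q|^2+\eta(x,\lambda,\mu),\qquad q=\max\Big\{g(x),-\tfrac1c\,p(x,\mu)\mu\Big\},$$ if $x\in\Omega$, and $\mathscr L(x,\lambda,\mu,c)=+\infty$ otherwise. Let also $$Q(x)[\lambda,\mu]=\tfrac12\big\|DF(x)[v]\big\|^2+\tfrac12\big|\nabla g(x)v+\operatorname{diag}(g_i(x)^2)\mu\big|^2,\qquad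 v=DF(x)^*[\lambda]+\sum_{i=1}^m\mu_i\nabla g_i(x),$$ $$\Omega_r(\gamma)=\Big\{x\in\Omega : f(x)+r\big(\|F(x)\|^2+|\max\{g(x),0\}|^2\big)\le\gamma\Big\}.$$ Assume the following. 1. $f$, $F$ and all $g_i$ are twice continuously Fréchet differentiable on $\Omega$, $\phi$ is continuously differentiable on $\operatorname{dom}\phi$, and $\phi'(0)>0$. 2. For all $c>0$ the function $(x,\lambda,\mu)\mapsto\mathscr L(x,\lambda,\mu,c)$ is weakly sequentially lower semicontinuous on $X\times H\times\mathbb{R}^m$. 3. The set $\Omega_r(f_*+\varepsilon)$ is bounded for some $r>0$ and $\varepsilon>0$. 4. The functions $f$, $F$, $g_i$ and their first and second order Fréchet derivatives are bounded on $\Omega_r(f_*+\varepsilon)$. 5. There exists $a>0$ such that $Q(x)[\lambda,\mu]\ge a(\|\lambda\|^2+|\mu|^2)$ for all $x\in\Omega_r(f_*+\varepsilon)$, $\lambda\in H$, $\mu\in\mathbb{R}^m$. Then the augmented Lagrangian is globally exact: there exists $c_*>0$ such that for all $c\ge c_*$ a triplet $(x_*,\lambda_*,\mu_*)\in X\times H\times\mathbb{R}^m$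 is a global minimiser of $\mathscr L(\cdot,c)$ over $X\times H\times\mathbb{R}^m$ if and only if $x_*$ is a globally optimal solution of $(\mathcal P)$ and $(x_*,\lambda_*,\mu_*)$ is a KKT-point of $(\mathcal P)$, that is, $\nabla_xL(x_*,\lambda_*,\mu_*)=0$, $F(x_*)=0$ and $\max\{g(x_*),-\mu_*\}=0$. -/

import Mathlib

open Filter Topology
open scoped NNReal ENNReal

noncomputable section

namespace ExactAL

/-- Euclidean space `ℝᵐ`. -/
abbrev Rm (m : ℕ) : Type := EuclideanSpace ℝ (Fin m)

/-! ### The constrained problem: minimise `f` subject to `F x = 0`, `g i x ≤ 0` -/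

section Problem

variable {X H : Type*} [NormedAddCommGroup X] [InnerProductSpace ℝ X] [CompleteSpace X]
  [NormedAddCommGroup H] [InnerProductSpace ℝ H] [CompleteSpace H] {m : ℕ}

/-- The feasible set. -/
def feasibleSet (F : X → H) (g : Fin m → X → ℝ) : Set X :=
  {x | F x = 0 ∧ ∀ i, g i x ≤ 0}

/-- `x` is a globally optimal solution of the constrained problem. -/
def IsGlobalSolution (f : X → ℝ) (F : X → H) (g : Fin m → X → ℝ) (x : X) : Prop :=
  x ∈ feasibleSet F g ∧ ∀ y ∈ feasibleSet F g, f x ≤ f y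

/-- The vector `g(x) ∈ ℝᵐ`. -/
def gVec (g : Fin m → X → ℝ) (x : X) : Rm m := WithLp.toLp 2 fun i => g i x

/-- The vector `max {g(x), 0} ∈ ℝᵐ`. -/
def gPlus (g : Fin m → X → ℝ) (x : X) : Rm m := WithLp.toLp 2 fun i => max (g i x) 0

/-- The vector `∇g(x) y ∈ ℝᵐ` with coordinates `⟨∇gᵢ(x), y⟩`. -/
def gradG (g : Fin m → X → ℝ) (x y : X) : Rm m :=
  WithLp.toLp 2 fun i => inner ℝ (gradient (g i) x) y

/-- The vector `diag(gᵢ(x)²) μ ∈ ℝᵐ`. -/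
def diagSq (g : Fin m → X → ℝ) (x : X) (mu : Rm m) : Rm m :=
  WithLp.toLp 2 fun i => g i x ^ 2 * mu i

/-- The classical Lagrangian `L(x, λ, μ)`. -/
def lagrangian (f : X → ℝ) (F : X → H) (g : Fin m → X → ℝ) (x : X) (lam : H) (mu : Rm m) : ℝ :=
  f x + inner ℝ lam (F x) + inner ℝ mu (gVec g x)

/-- The gradient `∇ₓ L(x, λ, μ)`. -/
def gradLagrangian (f : X → ℝ) (F : X → H) (g : Fin m → X → ℝ)
    (x : X) (lam : H) (mu : Rm m) : X :=
  gradient (fun y => lagrangian f F g y lam mu) x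

/-- `(x, λ, μ)` is a KKT-point of the constrained problem. -/
def IsKKT (f : X → ℝ) (F : X → H) (g : Fin m → X → ℝ) (x : X) (lam : H) (mu : Rm m) : Prop :=
  gradLagrangian f F g x lam mu = 0 ∧ F x = 0 ∧ ∀ i, max (g i x) (-(mu i)) = 0

/-- The quadratic function `Q(x)[λ, μ]`. -/
def quadQ (F : X → H) (g : Fin m → X → ℝ) (x : X) (lam : H) (mu : Rm m) : ℝ :=
  1 / 2 * ‖fderiv ℝ F x
      (ContinuousLinearMap.adjoint (fderiv ℝ F x) lam + ∑ i, mu i • gradient (g i) x)‖ ^ 2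
  + 1 / 2 * ‖gradG g x
      (ContinuousLinearMap.adjoint (fderiv ℝ F x) lam + ∑ i, mu i • gradient (g i) x)
      + diagSq g x mu‖ ^ 2

/-- The term `η(x, λ, μ)`, which penalises the violation of the KKT conditions. -/
def eta (f : X → ℝ) (F : X → H) (g : Fin m → X → ℝ) (x : X) (lam : H) (mu : Rm m) : ℝ :=
  1 / 2 * ‖fderiv ℝ F x (gradLagrangian f F g x lam mu)‖ ^ 2
  + 1 / 2 * ∑ i, (inner ℝ (gradient (g i) x) (gradLagrangian f F g x lam mu)
      + g i x ^ 2 * mu i) ^ 2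

end Problem

/-! ### The functions `φ` and `ψ` -/

/-- The standing assumptions on `φ : [0, ∞) → [0, ∞]`; the last field says `dom φ ≠ {0}`. -/
structure IsPenaltyFun (φ : ℝ≥0 → ℝ≥0∞) : Prop where
  convex : ConvexOn ℝ≥0 Set.univ φ
  mono : Monotone φ
  lsc : LowerSemicontinuous φ
  eq_zero_iff : ∀ t, φ t = 0 ↔ t = 0
  dom_ne : ∃ t, t ≠ 0 ∧ φ t < ⊤

/-- The effective domain of `φ`, as a subset of `ℝ` contained in `[0, ∞)`. -/
def phiDom (φ : ℝ≥0 → ℝ≥0∞) : Set ℝ := {t | 0 ≤ t ∧ φ t.toNNReal < ⊤}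

/-- The real values of `φ`; only used on the effective domain. -/
def phiReal (φ : ℝ≥0 → ℝ≥0∞) (t : ℝ) : ℝ := (φ t.toNNReal).toReal

/-- The nonnegative orthant `[0, ∞)ᵐ`. -/
def orthant (m : ℕ) : Set (Rm m) := {y | ∀ i, 0 ≤ y i}

/-- The standing assumptions on `ψ : [0, ∞)ᵐ → ℝ`. Values of `ψ` off the orthant play no role. -/
structure IsBarrierFun {m : ℕ} (ψ : Rm m → ℝ) : Prop where
  contDiffOn : ContDiffOn ℝ 1 ψ (orthant m)
  concave : ConcaveOn ℝ (orthant m) ψ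
  pos : 0 < ψ 0
  max_zero : ∀ y ∈ orthant m, ψ y ≤ ψ 0
  partial_eq_zero : ∀ y ∈ orthant m, ∀ i, y i = 0 →
    fderivWithin ℝ ψ (orthant m) y (EuclideanSpace.single i 1) = 0

/-! ### The augmented Lagrangian -/

section AugmentedLagrangian

variable {X H : Type*} [NormedAddCommGroup X] [InnerProductSpace ℝ X] [CompleteSpace X]
  [NormedAddCommGroup H] [InnerProductSpace ℝ H] [CompleteSpace H] {m : ℕ}

/-- `b(x) = ψ(max {g(x), 0})`. -/
def bFun (g : Fin m → X → ℝ) (ψ : Rm m → ℝ) (x : X) : ℝ := ψ (gPlus g x)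

/-- `p(x, μ) = b(x) / (1 + |μ|²)`. -/
def pFun (g : Fin m → X → ℝ) (ψ : Rm m → ℝ) (x : X) (mu : Rm m) : ℝ :=
  bFun g ψ x / (1 + ‖mu‖ ^ 2)

/-- `Ω = {x | b(x) > 0, φ(‖F(x)‖²) < +∞}`. -/
def Omega (F : X → H) (g : Fin m → X → ℝ) (φ : ℝ≥0 → ℝ≥0∞) (ψ : Rm m → ℝ) : Set X :=
  {x | 0 < bFun g ψ x ∧ φ (‖F x‖₊ ^ 2) < ⊤}

/-- `Ω_c(γ) = {x ∈ Ω | f(x) + c (‖F(x)‖² + |max {g(x), 0}|²) ≤ γ}`. -/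
def OmegaSub (f : X → ℝ) (F : X → H) (g : Fin m → X → ℝ) (φ : ℝ≥0 → ℝ≥0∞) (ψ : Rm m → ℝ)
    (c γ : ℝ) : Set X :=
  {x | x ∈ Omega F g φ ψ ∧ f x + c * (‖F x‖ ^ 2 + ‖gPlus g x‖ ^ 2) ≤ γ}

/-- The vector `max {g(x), -(1/c) p(x, μ) μ} ∈ ℝᵐ`. -/
def qVec (g : Fin m → X → ℝ) (ψ : Rm m → ℝ) (x : X) (mu : Rm m) (c : ℝ) : Rm m :=
  WithLp.toLp 2 fun i => max (g i x) (-(1 / c) * pFun g ψ x mu * mu i)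

/-- The expression of the augmented Lagrangian on `Ω`. -/
def augLagrangianReal (f : X → ℝ) (F : X → H) (g : Fin m → X → ℝ) (φ : ℝ≥0 → ℝ≥0∞)
    (ψ : Rm m → ℝ) (c : ℝ) (x : X) (lam : H) (mu : Rm m) : ℝ :=
  f x + inner ℝ lam (F x)
    + c / 2 * (1 + ‖lam‖ ^ 2) * (φ (‖F x‖₊ ^ 2)).toReal
    + inner ℝ mu (qVec g ψ x mu c)
    + c / (2 * pFun g ψ x mu) * ‖qVec g ψ x mu c‖ ^ 2
    + eta f F g x lam mu

open Classical in
/-- The augmented Lagrangian as a function of `(x, λ, μ)`, equal to `+∞` for `x ∉ Ω`. -/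
def augLagrangian (f : X → ℝ) (F : X → H) (g : Fin m → X → ℝ) (φ : ℝ≥0 → ℝ≥0∞)
    (ψ : Rm m → ℝ) (c : ℝ) (z : X × H × Rm m) : EReal :=
  if z.1 ∈ Omega F g φ ψ then
    ((augLagrangianReal f F g φ ψ c z.1 z.2.1 z.2.2 : ℝ) : EReal)
  else ⊤

/-- Global exactness: for all large `c`, the global minimisers of the augmented Lagrangian are
exactly the KKT-points whose first component is a globally optimal solution. -/
def IsGloballyExact (f : X → ℝ) (F : X → H) (g : Fin m → X → ℝ) (φ : ℝ≥0 → ℝ≥0∞)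
    (ψ : Rm m → ℝ) : Prop :=
  ∃ cstar : ℝ, 0 < cstar ∧ ∀ c : ℝ, cstar ≤ c → ∀ (x : X) (lam : H) (mu : Rm m),
    (∀ z : X × H × Rm m, augLagrangian f F g φ ψ c (x, lam, mu) ≤ augLagrangian f F g φ ψ c z) ↔
      (IsGlobalSolution f F g x ∧ IsKKT f F g x lam mu)

end AugmentedLagrangian

/-! ### Weak sequential lower semicontinuity and bounded derivatives -/

/-- Weak sequential lower semicontinuity of an extended-real-valued function. -/
def WeaklySeqLSC {Z : Type*} [NormedAddCommGroup Z] [NormedSpace ℝ Z] (G : Z → EReal) : Prop :=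
  ∀ (u : ℕ → Z) (z : Z),
    Tendsto (fun n => toWeakSpace ℝ Z (u n)) atTop (𝓝 (toWeakSpace ℝ Z z)) →
      G z ≤ liminf (fun n => G (u n)) atTop

/-- `G` and its first and second order Fréchet derivatives are bounded on `V`. -/
def BoundedC2On {X Y : Type*} [NormedAddCommGroup X] [NormedSpace ℝ X]
    [NormedAddCommGroup Y] [NormedSpace ℝ Y] (G : X → Y) (V : Set X) : Prop :=
  ∃ B : ℝ, ∀ x ∈ V, ‖G x‖ ≤ B ∧ ‖fderiv ℝ G x‖ ≤ B ∧ ‖fderiv ℝ (fderiv ℝ G) x‖ ≤ B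

end ExactAL

end

set_option linter.unusedSectionVars false

noncomputable section

namespace ExactAL

/-! Write z = (λ, μ), G = (F, g), J for the derivative of G, and S = J J* + diag(0, gᵢ²) (`gramOp`).
Then Q(x)[z] = ½‖S z‖² and η = ½‖A‖², where A = J∇f + S z (`kktRes`) is affine in z. Assumption 5
says that the self-adjoint operator S is bounded below on Ω_r(f_* + ε), hence invertible there. At a
global solution this yields multipliers (`exists_isKKT`), and at every KKT-point the augmented
Lagrangian equals f.

Completing squares in λ and μ shows that, up to O(1/c), the augmented Lagrangian dominates f plus c
times the squares of F and q, plus η. So for large c its sublevel set at f_* lies over Ω_r(f_* + ε),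
and there z, A, c‖F‖² and c|q|² are bounded independently of c (`exists_sublevel_bound`).

The core is that every global minimiser is a KKT-point once c is large. The maximum in q is removed
by writing the augmented Lagrangian as a minimum over slacks s ≥ 0; freezing the optimal slack
leaves a differentiable function. Stationarity in x reads ∇L + c J* y = e, where y (`penVec`)
dominates F and q, and e is O(c|q|² + ‖A‖). Applying J and inverting S gives c‖y‖ = O(‖A‖).
Stationarity in z reads S A = -(F + ..., q + ...), which gives ‖A‖ = O(N + cN²) with N = ‖F‖ + |q|.
Together these give c‖A‖ = O(‖A‖), so A = 0 and y = 0 for large c (`exists_threshold`). Hence F = 0,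
q = 0, e = 0 and ∇L = 0.

The converse needs a minimiser to exist, which follows from weak lower semicontinuity and bounded
sublevel sets. It is a KKT-point over a global solution, so the minimum is f_*, the value taken at
all such points. -/

/-! ### Weak sequential compactness and existence of minimisers -/

/-- Bounded sequences in a Hilbert space have weakly convergent subsequences. -/
theorem exists_subseq_inner_tendsto {E : Type*} [NormedAddCommGroup E] [InnerProductSpace ℝ E]
    [CompleteSpace E] (u : ℕ → E) (R : ℝ) (hu : ∀ n, ‖u n‖ ≤ R) :
    ∃ (x : E) (s : ℕ → ℕ), StrictMono s ∧
      ∀ w : E, Tendsto (fun n => (inner ℝ w (u (s n)) : ℝ)) atTop (𝓝 (inner ℝ w x)) := by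
  -- The closed span of the sequence is separable, so closed balls of its dual are weak-*
  -- sequentially compact.
  let K : Submodule ℝ E := (Submodule.span ℝ (Set.range u)).topologicalClosure
  have hK : IsClosed (K : Set E) := Submodule.isClosed_topologicalClosure _
  have hsep : TopologicalSpace.IsSeparable (K : Set E) := by
    rw [Submodule.topologicalClosure_coe]
    exact ((Set.countable_range u).isSeparable.span (R := ℝ)).closure
  have : CompleteSpace K := hK.completeSpace_coe
  have : TopologicalSpace.SeparableSpace K := hsep.separableSpace
  have huK : ∀ n, u n ∈ K := fun n =>
    Submodule.le_topologicalClosure _ (Submodule.subset_span ⟨n, rfl⟩)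
  let v : ℕ → K := fun n => ⟨u n, huK n⟩
  let d : ℕ → WeakDual ℝ K := fun n =>
    StrongDual.toWeakDual (InnerProductSpace.toDual ℝ K (v n))
  have hd : ∀ n, d n ∈ WeakDual.toStrongDual ⁻¹'
      Metric.closedBall (0 : StrongDual ℝ K) R := by
    intro n
    have : ‖InnerProductSpace.toDual ℝ K (v n)‖ ≤ R := by
      rw [LinearIsometryEquiv.norm_map]; exact hu n
    exact mem_closedBall_zero_iff.2 this
  obtain ⟨l, -, s, hs, hl⟩ := WeakDual.isSeqCompact_closedBall ℝ K 0 R hd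
  let x : K := (InnerProductSpace.toDual ℝ K).symm (WeakDual.toStrongDual l)
  refine ⟨x, s, hs, fun w => ?_⟩
  have h1 := ((WeakDual.eval_continuous (𝕜 := ℝ) (E := K)
    (K.orthogonalProjectionOnto w)).tendsto l).comp hl
  -- Elements of `K` see a test vector only through its projection, so weak convergence in `K` is
  -- weak convergence in `E`.
  have h2 : ∀ y : K, (inner ℝ w (y : E) : ℝ) = inner ℝ y (K.orthogonalProjectionOnto w) := by
    intro y
    rw [real_inner_comm, Submodule.inner_orthogonalProjectionOnto_eq_of_mem_left]
  have h3 : l (K.orthogonalProjectionOnto w) = inner ℝ w (x : E) := by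
    rw [h2]
    simp only [x]
    rw [InnerProductSpace.toDual_symm_apply]; rfl
  rw [← h3]
  refine h1.congr fun n => ?_
  show _ = inner ℝ w ((v (s n) : K) : E)
  rw [h2]
  rfl

/-- Continuous linear images of weakly convergent sequences in a Hilbert space converge weakly. -/
theorem tendsto_toWeakSpace_of_inner {E Y : Type*} [NormedAddCommGroup E] [InnerProductSpace ℝ E]
    [CompleteSpace E] [NormedAddCommGroup Y] [NormedSpace ℝ Y] (T : E →L[ℝ] Y) (u : ℕ → E) (x : E)
    (h : ∀ w : E, Tendsto (fun n => (inner ℝ w (u n) : ℝ)) atTop (𝓝 (inner ℝ w x))) :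
    Tendsto (fun n => toWeakSpace ℝ Y (T (u n))) atTop (𝓝 (toWeakSpace ℝ Y (T x))) := by
  refine (WeakBilin.tendsto_iff_forall_eval_tendsto _ fun y y' hyy => ?_).2 fun l => ?_
  · exact (SeparatingDual.eq_iff_forall_dual_eq (R := ℝ)).2 fun l => LinearMap.congr_fun hyy l
  · have h1 := h ((InnerProductSpace.toDual ℝ E).symm (l.comp T))
    simp only [InnerProductSpace.toDual_symm_apply] at h1
    exact h1

/-- A weakly sequentially lower semicontinuous function with values in `EReal` whose values below
some attained value are taken on a bounded set has a global minimiser. -/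
theorem exists_minimiser {E Y : Type*} [NormedAddCommGroup E] [InnerProductSpace ℝ E]
    [CompleteSpace E] [NormedAddCommGroup Y] [NormedSpace ℝ Y] (T : E ≃L[ℝ] Y) (G : Y → EReal)
    (hG : WeaklySeqLSC G) (z₀ : Y) (R : ℝ) (hR : ∀ z, G z ≤ G z₀ → ‖z‖ ≤ R) :
    ∃ z, ∀ w, G z ≤ G w := by
  by_cases h0 : ∀ w, G z₀ ≤ G w
  · exact ⟨z₀, h0⟩
  push Not at h0
  obtain ⟨w₀, hw₀⟩ := h0
  have hne : (Set.range G).Nonempty := ⟨_, w₀, rfl⟩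
  obtain ⟨v, -, hv, hvm⟩ := exists_seq_tendsto_sInf hne (OrderBot.bddBelow _)
  choose u hu using hvm
  have hlt : sInf (Set.range G) < G z₀ := lt_of_le_of_lt (sInf_le ⟨w₀, rfl⟩) hw₀
  obtain ⟨N, hN⟩ := eventually_atTop.1 (hv.eventually (gt_mem_nhds hlt))
  -- The infimum is strictly below `G z₀`, so a tail of the minimising sequence stays in the bounded
  -- sublevel set.
  let y : ℕ → Y := fun n => u (n + N)
  have hy : ∀ n, ‖y n‖ ≤ R := fun n => hR _ (by
    have := hN (n + N) (by omega)
    rw [← hu] at this; exact this.le)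
  -- The norm of `Y` need not be Hilbertian (it is a product norm in the application), so
  -- compactness is used in `E` and carried over by `T`.
  obtain ⟨x, s, hs, hx⟩ := exists_subseq_inner_tendsto (fun n => T.symm (y n))
    (‖(T.symm : Y →L[ℝ] E)‖ * R) (fun n =>
      ((T.symm : Y →L[ℝ] E).le_opNorm _).trans (by gcongr; exact hy n))
  have hw := tendsto_toWeakSpace_of_inner (T : E →L[ℝ] Y) _ x hx
  have h1 := hG (fun n => y (s n)) (T x) (by simpa using hw)
  have h2 : Tendsto (fun n => G (y (s n))) atTop (𝓝 (sInf (Set.range G))) := by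
    have h3 : Tendsto (fun n => s n + N) atTop atTop :=
      tendsto_atTop_mono (fun n => Nat.le_add_right _ _) hs.tendsto_atTop
    refine (hv.comp h3).congr fun n => ?_
    simp [y, hu]
  rw [h2.liminf_eq] at h1
  exact ⟨T x, fun w => h1.trans (sInf_le ⟨w, rfl⟩)⟩

/-! ### Right inverses and Lyusternik curves -/

/-- A symmetric operator that is bounded below has a continuous right inverse. -/
theorem exists_rightInverse_of_symmetric {Z : Type*} [NormedAddCommGroup Z]
    [InnerProductSpace ℝ Z] [CompleteSpace Z] (S : Z →L[ℝ] Z)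
    (hS : ∀ z w, (inner ℝ (S z) w : ℝ) = inner ℝ z (S w)) (a : ℝ) (ha : 0 < a)
    (hb : ∀ z, a * ‖z‖ ^ 2 ≤ ‖S z‖ ^ 2) : ∃ W : Z →L[ℝ] Z, ∀ z, S (W z) = z := by
  -- Lax–Milgram for ⟨S²z, w⟩, which is coercive because ⟨S²z, z⟩ = ‖S z‖². Thus S² is invertible
  -- and S (S²)⁻¹ is a right inverse of S.
  let B : Z →L[ℝ] Z →L[ℝ] ℝ := (innerSL ℝ).comp (S.comp S)
  have hB : IsCoercive B := ⟨a, ha, fun u => by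
    have : B u u = ‖S u‖ ^ 2 := by
      simp only [B, ContinuousLinearMap.comp_apply, innerSL_apply_apply]
      rw [hS, real_inner_self_eq_norm_sq]
    rw [this, mul_assoc, ← sq]
    exact hb u⟩
  let e := hB.continuousLinearEquivOfBilin
  have he : ∀ z, e z = S (S z) := fun z => by
    refine ext_inner_right ℝ fun w => ?_
    rw [hB.continuousLinearEquivOfBilin_apply]
    rfl
  refine ⟨S.comp (e.symm : Z →L[ℝ] Z), fun z => ?_⟩
  rw [ContinuousLinearMap.comp_apply, ← he]
  exact e.apply_symm_apply z

/-- Lyusternik-type lemma: if the part `Π G` of a constraint has a derivative with a continuous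
right inverse, then in every direction `v` there is a differentiable curve along which `Π G`
changes exactly linearly. -/
theorem exists_curve {X Z : Type*} [NormedAddCommGroup X] [NormedSpace ℝ X] [CompleteSpace X]
    [NormedAddCommGroup Z] [NormedSpace ℝ Z] (G : X → Z) (T : X →L[ℝ] Z) (x₀ : X)
    (hG : HasStrictFDerivAt G T x₀) (Pr : Z →L[ℝ] Z) (R : Z →L[ℝ] X)
    (hPr : ∀ z, Pr (Pr z) = Pr z) (hR : ∀ z, Pr (T (R z)) = Pr z) (v : X) :
    ∃ γ : ℝ → X, γ 0 = x₀ ∧ HasDerivAt γ v 0 ∧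
      ∀ᶠ t in 𝓝 (0 : ℝ), Pr (G (γ t) - G x₀) = t • Pr (T v) := by
  -- `Φ` has the identity as derivative at `x₀`, hence a local inverse. Since `Pr T R' = Pr` and `Pr
  -- T P = 0`, the map `Pr T Φ` is exactly the increment of `Pr G`, and the preimage of the line `t
  -- • v` is the required curve.
  let R' : Z →L[ℝ] X := R.comp Pr
  let P : X →L[ℝ] X := ContinuousLinearMap.id ℝ X - R'.comp T
  let Φ : X → X := fun x => R' (G x - G x₀) + P (x - x₀)
  have hΦ0 : Φ x₀ = 0 := by simp [Φ]
  have hΦ : HasStrictFDerivAt Φ ((ContinuousLinearEquiv.refl ℝ X : X ≃L[ℝ] X) : X →L[ℝ] X) x₀ := by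
    have h1 : HasStrictFDerivAt (fun x => R' (G x - G x₀)) (R'.comp T) x₀ :=
      R'.hasStrictFDerivAt.comp x₀ (hG.sub_const _)
    have h2 : HasStrictFDerivAt (fun x => P (x - x₀)) (P.comp (ContinuousLinearMap.id ℝ X)) x₀ :=
      P.hasStrictFDerivAt.comp x₀ ((hasStrictFDerivAt_id x₀).sub_const _)
    refine (h1.add h2).congr_fderiv ?_
    ext y
    simp [P]
  have hT : ∀ x, Pr (T (Φ x)) = Pr (G x - G x₀) := fun x => by
    simp only [Φ, P, R', map_add, map_sub, ContinuousLinearMap.comp_apply,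
      sub_apply, ContinuousLinearMap.id_apply, hR, hPr]
    abel
  let h := hΦ.localInverse Φ (ContinuousLinearEquiv.refl ℝ X) x₀
  have hd : HasStrictFDerivAt h ((ContinuousLinearEquiv.refl ℝ X).symm : X →L[ℝ] X) (Φ x₀) :=
    hΦ.to_localInverse
  have hinv : ∀ᶠ y in 𝓝 (Φ x₀), Φ (h y) = y := hΦ.eventually_right_inverse
  rw [hΦ0] at hd hinv
  have hline : HasDerivAt (fun t : ℝ => t • v) v 0 := by
    simpa using (hasDerivAt_id (0 : ℝ)).smul_const v
  have hcont : Tendsto (fun t : ℝ => t • v) (𝓝 0) (𝓝 0) := by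
    simpa using hline.continuousAt.tendsto
  refine ⟨fun t => h (t • v), ?_, ?_, ?_⟩
  · have : h (Φ x₀) = x₀ := hΦ.localInverse_apply_image
    simpa [hΦ0] using this
  · have h0 : HasFDerivAt h ((ContinuousLinearEquiv.refl ℝ X).symm : X →L[ℝ] X) ((0 : ℝ) • v) := by
      simpa using hd.hasFDerivAt
    exact h0.comp_hasDerivAt 0 hline
  · filter_upwards [hcont.eventually hinv] with t ht
    rw [← hT, ht, map_smul, map_smul]

/-! ### The Hilbert space of multipliers -/

variable {H : Type*} [NormedAddCommGroup H] [InnerProductSpace ℝ H] {m : ℕ}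

/-- The Hilbert space `H × ℝᵐ` of multipliers. -/
def Mult (H : Type*) (m : ℕ) : Type _ := WithLp 2 (H × Rm m)

instance : NormedAddCommGroup (Mult H m) :=
  inferInstanceAs (NormedAddCommGroup (WithLp 2 (H × Rm m)))

instance : InnerProductSpace ℝ (Mult H m) :=
  inferInstanceAs (InnerProductSpace ℝ (WithLp 2 (H × Rm m)))

instance [CompleteSpace H] : CompleteSpace (Mult H m) := inferInstanceAs (CompleteSpace (WithLp 2 (H × Rm m)))

/-- The multiplier with components `λ` and `μ`. -/
def mult (lam : H) (mu : Rm m) : Mult H m := (WithLp.toLp 2 (lam, mu) : WithLp 2 (H × Rm m))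

theorem inner_mult (lam lam' : H) (mu mu' : Rm m) :
    (inner ℝ (mult lam mu) (mult lam' mu') : ℝ) = inner ℝ lam lam' + inner ℝ mu mu' := by
  change inner ℝ (WithLp.toLp 2 (lam, mu) : WithLp 2 (H × Rm m)) (WithLp.toLp 2 (lam', mu')) = _
  simp [WithLp.prod_inner_apply]

theorem norm_mult_sq (lam : H) (mu : Rm m) : ‖mult lam mu‖ ^ 2 = ‖lam‖ ^ 2 + ‖mu‖ ^ 2 := by
  rw [← real_inner_self_eq_norm_sq, inner_mult, real_inner_self_eq_norm_sq,
    real_inner_self_eq_norm_sq]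

theorem norm_mult_le (lam : H) (mu : Rm m) : ‖mult lam mu‖ ≤ ‖lam‖ + ‖mu‖ := by
  refine abs_le_of_sq_le_sq' ?_ (by positivity) |>.2
  rw [norm_mult_sq]
  nlinarith [norm_nonneg lam, norm_nonneg mu]

theorem norm_fst_le (lam : H) (mu : Rm m) : ‖lam‖ ≤ ‖mult lam mu‖ := by
  refine abs_le_of_sq_le_sq' ?_ (by positivity) |>.2
  rw [norm_mult_sq]
  nlinarith [norm_nonneg lam, norm_nonneg mu]

theorem norm_snd_le (lam : H) (mu : Rm m) : ‖mu‖ ≤ ‖mult lam mu‖ := by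
  refine abs_le_of_sq_le_sq' ?_ (by positivity) |>.2
  rw [norm_mult_sq]
  nlinarith [norm_nonneg lam, norm_nonneg mu]

theorem mult_add (lam lam' : H) (mu mu' : Rm m) :
    mult (lam + lam') (mu + mu') = mult lam mu + mult lam' mu' := rfl

theorem mult_smul (c : ℝ) (lam : H) (mu : Rm m) :
    mult (c • lam) (c • mu) = c • mult lam mu := rfl

theorem mult_neg (lam : H) (mu : Rm m) : mult (-lam) (-mu) = -mult lam mu := rfl

theorem mult_inj {lam lam' : H} {mu mu' : Rm m} (h : mult lam mu = mult lam' mu') :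
    lam = lam' ∧ mu = mu' := by
  have h1 : (lam, mu) = (lam', mu') := congrArg (fun z : WithLp 2 (H × Rm m) => WithLp.ofLp z) h
  simpa using h1

/-- The embedding of `H` into the space of multipliers. -/
def embH (H : Type*) [NormedAddCommGroup H] [InnerProductSpace ℝ H] (m : ℕ) : H →L[ℝ] Mult H m :=
  LinearMap.mkContinuous
    { toFun := fun h => mult h 0
      map_add' := fun h h' => by rw [← mult_add, add_zero]
      map_smul' := fun c h => by rw [RingHom.id_apply, ← mult_smul, smul_zero] } 1
    fun h => (norm_mult_le h 0).trans (by simp)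

theorem embH_apply (h : H) : embH H m h = mult h 0 := rfl

/-- The `i`-th coordinate axis of the space of multipliers. -/
def embR (H : Type*) [NormedAddCommGroup H] [InnerProductSpace ℝ H] {m : ℕ} (i : Fin m) :
    ℝ →L[ℝ] Mult H m :=
  ContinuousLinearMap.toSpanSingleton ℝ (mult (0 : H) (EuclideanSpace.single i 1))

theorem embR_apply (i : Fin m) (t : ℝ) :
    embR H i t = t • mult (0 : H) (EuclideanSpace.single i 1) := rfl

theorem sum_single_smul (w : Fin m → ℝ) :
    ∑ i, w i • (EuclideanSpace.single i 1 : Rm m) = WithLp.toLp 2 w := by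
  ext j
  simp [Finset.sum_apply, Pi.single_apply]

/-- Reduces differentiation of maps into the multiplier space to their components, through the
continuous linear embeddings. -/
theorem mult_eq_sum (h : H) (w : Fin m → ℝ) :
    mult h (WithLp.toLp 2 w) = embH H m h + ∑ i, embR H i (w i) := by
  have h1 : ∀ s : Finset (Fin m), ∑ i ∈ s, w i • mult (0 : H) (EuclideanSpace.single i 1)
      = mult (0 : H) (∑ i ∈ s, w i • (EuclideanSpace.single i 1 : Rm m)) := by
    intro s
    induction s using Finset.cons_induction with
    | empty => rfl
    | cons i s hi ih =>
      rw [Finset.sum_cons, Finset.sum_cons, ih, ← mult_smul, ← mult_add]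
      simp
  simp only [embH_apply, embR_apply, h1, sum_single_smul]
  rw [← mult_add]
  simp

/-- The coordinate projection `(λ, μ) ↦ (0, μᵢ eᵢ)`. -/
def coordOp (H : Type*) [NormedAddCommGroup H] [InnerProductSpace ℝ H] {m : ℕ} (i : Fin m) :
    Mult H m →L[ℝ] Mult H m :=
  (embR H i).comp (innerSL ℝ (mult (0 : H) (EuclideanSpace.single i 1)))

theorem coordOp_mult (i : Fin m) (lam : H) (mu : Rm m) :
    coordOp H i (mult lam mu) = embR H i (mu i) := by
  simp only [coordOp, ContinuousLinearMap.comp_apply, innerSL_apply_apply, inner_mult]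
  simp [EuclideanSpace.inner_single_left]

/-! ### The constraint map, the operator S and the KKT residual -/

variable {X : Type*} [NormedAddCommGroup X] [InnerProductSpace ℝ X] [CompleteSpace X]
  [CompleteSpace H]

/-- The constraint map `x ↦ (F(x), g(x))`. -/
def conMap (F : X → H) (g : Fin m → X → ℝ) (x : X) : Mult H m := mult (F x) (gVec g x)

theorem conMap_eq_sum (F : X → H) (g : Fin m → X → ℝ) :
    conMap F g = fun x => embH H m (F x) + ∑ i, embR H i (g i x) :=
  funext fun x => mult_eq_sum (F x) fun i => g i x

/-- The derivative of the constraint map. -/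
def jac (F : X → H) (g : Fin m → X → ℝ) (x : X) : X →L[ℝ] Mult H m := fderiv ℝ (conMap F g) x

theorem contDiff_conMap {F : X → H} {g : Fin m → X → ℝ} {n : WithTop ℕ∞} (hF : ContDiff ℝ n F)
    (hg : ∀ i, ContDiff ℝ n (g i)) : ContDiff ℝ n (conMap F g) := by
  rw [conMap_eq_sum]
  exact ((embH H m).contDiff.comp hF).add
    (ContDiff.sum fun i _ => (embR H i).contDiff.comp (hg i))

theorem jac_apply {F : X → H} {g : Fin m → X → ℝ} {x : X} (hF : DifferentiableAt ℝ F x)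
    (hg : ∀ i, DifferentiableAt ℝ (g i) x) (v : X) :
    jac F g x v = mult (fderiv ℝ F x v) (gradG g x v) := by
  have h : HasFDerivAt (conMap F g) ((embH H m).comp (fderiv ℝ F x)
      + ∑ i, (embR H i).comp (fderiv ℝ (g i) x)) x := by
    rw [conMap_eq_sum]
    exact ((embH H m).hasFDerivAt.comp x hF.hasFDerivAt).add
      (HasFDerivAt.fun_sum fun i _ => (embR H i).hasFDerivAt.comp x (hg i).hasFDerivAt)
  rw [jac, h.fderiv, gradG, mult_eq_sum]
  simp [inner_gradient_left]

/-- The adjoint of the derivative of the constraint map. -/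
theorem adjoint_jac {F : X → H} {g : Fin m → X → ℝ} {x : X} (hF : DifferentiableAt ℝ F x)
    (hg : ∀ i, DifferentiableAt ℝ (g i) x) (lam : H) (mu : Rm m) :
    ContinuousLinearMap.adjoint (jac F g x) (mult lam mu) =
      ContinuousLinearMap.adjoint (fderiv ℝ F x) lam + ∑ i, mu i • gradient (g i) x := by
  refine ext_inner_right ℝ fun v => ?_
  rw [ContinuousLinearMap.adjoint_inner_left, jac_apply hF hg, inner_mult, inner_add_left,
    ContinuousLinearMap.adjoint_inner_left, sum_inner]
  simp [PiLp.inner_apply, gradG, inner_smul_left, mul_comm]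

/-- The operator `(λ, μ) ↦ (0, diag(gᵢ(x)²) μ)`. -/
def slackOp (H : Type*) [NormedAddCommGroup H] [InnerProductSpace ℝ H] (g : Fin m → X → ℝ)
    (x : X) : Mult H m →L[ℝ] Mult H m := ∑ i, g i x ^ 2 • coordOp H i

theorem slackOp_mult (g : Fin m → X → ℝ) (x : X) (lam : H) (mu : Rm m) :
    slackOp H g x (mult lam mu) = mult 0 (diagSq g x mu) := by
  have h : slackOp H g x (mult lam mu) = ∑ i, g i x ^ 2 • embR H i (mu i) := by
    simp [slackOp, coordOp_mult]
  rw [h, diagSq, mult_eq_sum, map_zero, zero_add]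
  simp [embR_apply, smul_smul]

/-- The self-adjoint operator whose square is the quadratic form `2 Q(x)`. -/
def gramOp (F : X → H) (g : Fin m → X → ℝ) (x : X) : Mult H m →L[ℝ] Mult H m :=
  (jac F g x).comp (ContinuousLinearMap.adjoint (jac F g x)) + slackOp H g x

theorem gramOp_apply (F : X → H) (g : Fin m → X → ℝ) (x : X) (z : Mult H m) :
    gramOp F g x z =
      jac F g x (ContinuousLinearMap.adjoint (jac F g x) z) + slackOp H g x z := rfl

theorem exists_mult (z : Mult H m) : ∃ lam mu, z = mult lam mu := ⟨WithLp.fst z, WithLp.snd z, rfl⟩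

theorem gramOp_symm (F : X → H) (g : Fin m → X → ℝ) (x : X) (z w : Mult H m) :
    (inner ℝ (gramOp F g x z) w : ℝ) = inner ℝ z (gramOp F g x w) := by
  rw [gramOp_apply, gramOp_apply, inner_add_left, inner_add_right,
    ← ContinuousLinearMap.adjoint_inner_right, ← ContinuousLinearMap.adjoint_inner_left (jac F g x) _ z]
  congr 1
  obtain ⟨l, u, rfl⟩ := exists_mult z
  obtain ⟨l', u', rfl⟩ := exists_mult w
  rw [slackOp_mult, slackOp_mult, inner_mult, inner_mult]
  simp [PiLp.inner_apply, diagSq]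
  exact Finset.sum_congr rfl fun i _ => by ring

/-- Turns the positive definiteness of Q into a lower bound for a self-adjoint operator, from which
invertibility follows. -/
theorem quadQ_eq {F : X → H} {g : Fin m → X → ℝ} {x : X} (hF : DifferentiableAt ℝ F x)
    (hg : ∀ i, DifferentiableAt ℝ (g i) x) (lam : H) (mu : Rm m) :
    quadQ F g x lam mu = 1 / 2 * ‖gramOp F g x (mult lam mu)‖ ^ 2 := by
  rw [gramOp_apply, adjoint_jac hF hg, jac_apply hF hg, slackOp_mult, ← mult_add, norm_mult_sq,
    quadQ, add_zero]
  ring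

theorem gradLagrangian_eq {f : X → ℝ} {F : X → H} {g : Fin m → X → ℝ} {x : X}
    (hf : DifferentiableAt ℝ f x) (hF : DifferentiableAt ℝ F x)
    (hg : ∀ i, DifferentiableAt ℝ (g i) x) (lam : H) (mu : Rm m) :
    gradLagrangian f F g x lam mu =
      gradient f x + ContinuousLinearMap.adjoint (jac F g x) (mult lam mu) := by
  have hc : DifferentiableAt ℝ (conMap F g) x := by
    rw [conMap_eq_sum]
    exact ((embH H m).differentiableAt.comp x hF).add
      (DifferentiableAt.fun_sum fun i _ => (embR H i).differentiableAt.comp x (hg i))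
  have h1 : (fun y => lagrangian f F g y lam mu) =
      fun y => f y + innerSL ℝ (mult lam mu) (conMap F g y) := by
    funext y
    simp only [lagrangian, innerSL_apply_apply, conMap, inner_mult]
    ring
  refine HasGradientAt.gradient ?_
  rw [h1, hasGradientAt_iff_hasFDerivAt]
  refine (hf.hasFDerivAt.add ((innerSL ℝ (mult lam mu)).hasFDerivAt.comp x
    hc.hasFDerivAt)).congr_fderiv ?_
  ext v
  simp [ContinuousLinearMap.adjoint_inner_left, jac]

/-- The residual of the KKT system whose squared norm is `2 η`. -/
def kktRes (f : X → ℝ) (F : X → H) (g : Fin m → X → ℝ) (x : X) (z : Mult H m) : Mult H m :=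
  jac F g x (gradient f x) + gramOp F g x z

/-- The definition of the residual displays it as affine in the multiplier with linear part
`gramOp`, as needed for stationarity in (λ, μ). The form here ties it to ∇L, as needed for
stationarity in x. -/
theorem kktRes_eq {f : X → ℝ} {F : X → H} {g : Fin m → X → ℝ} {x : X}
    (hf : DifferentiableAt ℝ f x) (hF : DifferentiableAt ℝ F x)
    (hg : ∀ i, DifferentiableAt ℝ (g i) x) (lam : H) (mu : Rm m) :
    kktRes f F g x (mult lam mu) = jac F g x (gradLagrangian f F g x lam mu)
      + slackOp H g x (mult lam mu) := by
  rw [gradLagrangian_eq hf hF hg, map_add, kktRes, gramOp_apply, add_assoc]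

theorem eta_eq {f : X → ℝ} {F : X → H} {g : Fin m → X → ℝ} {x : X}
    (hf : DifferentiableAt ℝ f x) (hF : DifferentiableAt ℝ F x)
    (hg : ∀ i, DifferentiableAt ℝ (g i) x) (lam : H) (mu : Rm m) :
    eta f F g x lam mu = 1 / 2 * ‖kktRes f F g x (mult lam mu)‖ ^ 2 := by
  rw [kktRes_eq hf hF hg, jac_apply hF hg, slackOp_mult, ← mult_add, norm_mult_sq,
    EuclideanSpace.norm_sq_eq]
  simp only [eta, gradG, diagSq, add_zero, PiLp.add_apply, Real.norm_eq_abs, sq_abs]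
  ring

/-! ### Existence of Lagrange multipliers -/

theorem nonneg_of_hasDerivWithinAt_of_eventually_le {h : ℝ → ℝ} {h' : ℝ}
    (hd : HasDerivWithinAt h h' (Set.Ioi 0) 0)
    (hmin : ∀ᶠ t in 𝓝[>] (0 : ℝ), h 0 ≤ h t) : 0 ≤ h' := by
  have h1 := (hasDerivWithinAt_iff_tendsto_slope' (s := Set.Ioi (0 : ℝ)) (by simp)).1 hd
  refine ge_of_tendsto h1 ?_
  filter_upwards [hmin, self_mem_nhdsWithin] with t ht ht0
  rw [slope_def_field]
  have : (0 : ℝ) < t := ht0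
  exact div_nonneg (by linarith) (by linarith)

/-- The projection of the space of multipliers that forgets the inactive coordinates. -/
def activeProj (H : Type*) [NormedAddCommGroup H] [InnerProductSpace ℝ H] (g : Fin m → X → ℝ)
    (x : X) : Mult H m →L[ℝ] Mult H m :=
  ContinuousLinearMap.id ℝ (Mult H m) - ∑ i, (if g i x = 0 then (0 : ℝ) else 1) • coordOp H i

theorem activeProj_mult (g : Fin m → X → ℝ) (x : X) (lam : H) (mu : Rm m) :
    activeProj H g x (mult lam mu) =
      mult lam (WithLp.toLp 2 fun i => if g i x = 0 then mu i else 0) := by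
  have h : activeProj H g x (mult lam mu) =
      mult lam mu - ∑ i, (if g i x = 0 then (0 : ℝ) else 1) • embR H i (mu i) := by
    simp only [activeProj, sub_apply, ContinuousLinearMap.id_apply, sum_apply, smul_apply,
      coordOp_mult]
  have h2 : mult lam mu = embH H m lam + ∑ i, embR H i (mu i) := mult_eq_sum lam fun i => mu i
  rw [h, h2, mult_eq_sum, add_sub_assoc, ← Finset.sum_sub_distrib]
  congr 1
  refine Finset.sum_congr rfl fun i _ => ?_
  split_ifs <;> simp

/-- Existence of Lagrange multipliers at a global solution at which the quadratic form `Q` is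
positive definite. -/
theorem exists_isKKT {f : X → ℝ} {F : X → H} {g : Fin m → X → ℝ} (hf : ContDiff ℝ 1 f)
    (hF : ContDiff ℝ 1 F) (hg : ∀ i, ContDiff ℝ 1 (g i)) {x : X} (hx : IsGlobalSolution f F g x)
    {a : ℝ} (ha : 0 < a)
    (hQ : ∀ (lam : H) (mu : Rm m), a * (‖lam‖ ^ 2 + ‖mu‖ ^ 2) ≤ quadQ F g x lam mu) :
    ∃ lam mu, IsKKT f F g x lam mu := by
  have hfd : DifferentiableAt ℝ f x := (hf.differentiable one_ne_zero) x
  have hFd : DifferentiableAt ℝ F x := (hF.differentiable one_ne_zero) x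
  have hgd : ∀ i, DifferentiableAt ℝ (g i) x := fun i => ((hg i).differentiable one_ne_zero) x
  obtain ⟨W, hW⟩ := exists_rightInverse_of_symmetric (gramOp F g x) (gramOp_symm F g x) (2 * a)
    (by positivity) (fun z => by
      obtain ⟨l, u, rfl⟩ := exists_mult z
      have := hQ l u
      rw [quadQ_eq hFd hgd] at this
      rw [norm_mult_sq]
      linarith)
  set T := jac F g x with hT
  set Pr := activeProj H g x with hPrdef
  let R : Mult H m →L[ℝ] X := (ContinuousLinearMap.adjoint T).comp W
  have hPr : ∀ z, Pr (Pr z) = Pr z := by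
    intro z
    obtain ⟨l, u, rfl⟩ := exists_mult z
    simp only [hPrdef, activeProj_mult]
    congr 2
    funext i
    split_ifs <;> rfl
  -- T T* W z = z - slack(W z), and the slack term carries the factors gᵢ(x)², which vanish on the
  -- active coordinates, the only real ones that `Pr` keeps.
  have hR : ∀ z, Pr (T (R z)) = Pr z := by
    intro z
    have h1 : T (R z) = z - slackOp H g x (W z) := by
      have := hW z
      rw [gramOp_apply] at this
      rw [eq_sub_iff_add_eq]
      exact this
    rw [h1, map_sub]
    obtain ⟨l, u, hlu⟩ := exists_mult (W z)
    rw [hlu, slackOp_mult, hPrdef, activeProj_mult, sub_eq_self]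
    have : (fun i => if g i x = 0 then (diagSq g x u) i else 0) = fun _ => (0 : ℝ) := by
      funext i
      split_ifs with h
      · simp [diagSq, h]
      · rfl
    rw [this]
    rfl
  have hG : HasStrictFDerivAt (conMap F g) T x :=
    (contDiff_conMap hF hg).contDiffAt.hasStrictFDerivAt one_ne_zero
  -- directions that are feasible to first order do not decrease the objective
  have key : ∀ v (w : Rm m), Pr (T v) = mult 0 w → (∀ i, w i ≤ 0) → 0 ≤ fderiv ℝ f x v := by
    intro v w hv hw
    obtain ⟨γ, h0, hd, hlin⟩ := exists_curve (conMap F g) T x hG Pr R hPr hR v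
    have hfγ : HasDerivAt (fun t => f (γ t)) (fderiv ℝ f x v) 0 := by
      have : HasFDerivAt f (fderiv ℝ f x) (γ 0) := by rw [h0]; exact hfd.hasFDerivAt
      exact this.comp_hasDerivAt 0 hd
    refine nonneg_of_hasDerivWithinAt_of_eventually_le hfγ.hasDerivWithinAt ?_
    have hin : ∀ i, ∀ᶠ t in 𝓝 (0 : ℝ), g i x < 0 → g i (γ t) < 0 := by
      intro i
      by_cases h : g i x < 0
      · have hc : ContinuousAt (fun t => g i (γ t)) 0 :=
          ContinuousAt.comp (by rw [h0]; exact (hgd i).continuousAt) hd.continuousAt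
        have h' : g i (γ 0) < 0 := by rw [h0]; exact h
        filter_upwards [hc.eventually (gt_mem_nhds h')] with t ht _ using ht
      · exact Eventually.of_forall fun t h' => absurd h' h
    filter_upwards [nhdsWithin_le_nhds hlin, nhdsWithin_le_nhds (eventually_all.2 hin),
      self_mem_nhdsWithin] with t ht hin ht0
    rw [h0]
    refine hx.2 _ ?_
    have h1 : conMap F g (γ t) - conMap F g x =
        mult (F (γ t) - F x) (gVec g (γ t) - gVec g x) := rfl
    rw [h1, hv, hPrdef, activeProj_mult, ← mult_smul, smul_zero] at ht
    obtain ⟨hF0, hg0⟩ := mult_inj ht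
    rw [hx.1.1, sub_zero] at hF0
    refine ⟨hF0, fun i => ?_⟩
    rcases (hx.1.2 i).lt_or_eq with hlt | heq
    · exact (hin i hlt).le
    · have h2 := congrArg (fun y : Rm m => y i) hg0
      simp [heq, gVec] at h2
      rw [h2]
      exact mul_nonpos_of_nonneg_of_nonpos (le_of_lt ht0) (hw i)
  have key0 : ∀ v, Pr (T v) = 0 → fderiv ℝ f x v = 0 := by
    intro v hv
    have h1 := key v 0 hv (fun i => le_rfl)
    have h2 := key (-v) 0 (by rw [map_neg, map_neg, hv, neg_zero]; rfl) (fun i => le_rfl)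
    rw [map_neg] at h2
    linarith
  -- The multiplier is read off from -Df ∘ R ∘ Pr. Passing through `Pr` makes it vanish on inactive
  -- coordinates, which is complementarity.
  let ρ : Mult H m →L[ℝ] ℝ := -((fderiv ℝ f x).comp (R.comp Pr))
  obtain ⟨lam, mu, hz⟩ := exists_mult ((InnerProductSpace.toDual ℝ (Mult H m)).symm ρ)
  have hρ : ∀ z, (inner ℝ (mult lam mu) z : ℝ) = -(fderiv ℝ f x (R (Pr z))) := by
    intro z
    rw [← hz, InnerProductSpace.toDual_symm_apply]
    rfl
  have hmu : ∀ i, mu i = -(fderiv ℝ f x (R (Pr (mult 0 (EuclideanSpace.single i 1))))) := by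
    intro i
    rw [← hρ, inner_mult]
    simp [EuclideanSpace.inner_single_right]
  refine ⟨lam, mu, ?_, hx.1.1, fun i => ?_⟩
  · rw [gradLagrangian_eq hfd hFd hgd]
    refine ext_inner_right ℝ fun v => ?_
    rw [inner_add_left, inner_gradient_left, ContinuousLinearMap.adjoint_inner_left, hρ,
      inner_zero_left]
    -- Subtracting `R (Pr (T v))` projects `v` into the kernel of `Pr T`, where Df vanishes.
    have h1 := key0 (v - R (Pr (T v))) (by rw [map_sub, map_sub, hR, hPr, sub_self])
    rw [map_sub] at h1
    linarith
  · rcases (hx.1.2 i).lt_or_eq with hlt | heq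
    · have : Pr (mult (0 : H) (EuclideanSpace.single i 1)) = 0 := by
        rw [hPrdef, activeProj_mult]
        have : (fun j => if g j x = 0 then (EuclideanSpace.single i (1 : ℝ) : Rm m) j else 0)
            = fun _ => (0 : ℝ) := by
          funext j
          split_ifs with h
          · have hji : j ≠ i := by rintro rfl; exact hlt.ne h
            simp [hji]
          · rfl
        rw [this]
        rfl
      rw [hmu, this]
      simpa using hlt.le
    · have h1 : Pr (mult (0 : H) (EuclideanSpace.single i 1)) =
          mult 0 (EuclideanSpace.single i 1) := by
        rw [hPrdef, activeProj_mult]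
        congr 1
        ext j
        by_cases hji : j = i
        · subst hji; simp [heq]
        · simp [hji]
      -- To first order this direction decreases gᵢ alone among the active constraints, so Df is
      -- nonnegative along it; this says μᵢ ≥ 0.
      have h2 := key (-(R (mult (0 : H) (EuclideanSpace.single i 1)))) (-EuclideanSpace.single i 1)
        (by
          rw [map_neg, map_neg, hR, h1, ← mult_neg, neg_zero])
        (fun j => by
          by_cases hji : j = i
          · subst hji; simp
          · simp [hji])
      rw [map_neg] at h2
      rw [hmu, h1, heq]
      exact max_eq_left (by linarith)

/-! ### Complementarity and the value at KKT-points -/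

/-- The equation encodes a ≤ 0, b ≥ 0 and ab = 0, conditions that are invariant under positive
scaling of b. -/
theorem max_neg_eq_zero_iff_mul {a b k : ℝ} (hk : 0 < k) :
    max a (-(k * b)) = 0 ↔ max a (-b) = 0 := by
  have h1 : -(k * b) = 0 ↔ -b = 0 := by simp [hk.ne']
  have h2 : -(k * b) ≤ 0 ↔ -b ≤ 0 := by simp [hk]
  rw [max_eq_iff, max_eq_iff]
  constructor
  · rintro (⟨h, h'⟩ | ⟨h, h'⟩)
    · exact Or.inl ⟨h, by rw [h] at h' ⊢; exact h2.1 h'⟩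
    · exact Or.inr ⟨h1.1 h, by rw [h1.1 h]; rwa [h] at h'⟩
  · rintro (⟨h, h'⟩ | ⟨h, h'⟩)
    · exact Or.inl ⟨h, by rw [h] at h' ⊢; exact h2.2 h'⟩
    · exact Or.inr ⟨h1.2 h, by rw [h1.2 h]; rwa [h] at h'⟩

/-- The complementarity condition `max {g(x), -μ} = 0` in terms of the vector `q`. -/
theorem qVec_eq_zero_iff {g : Fin m → X → ℝ} {ψ : Rm m → ℝ} {x : X} {mu : Rm m}
    (hb : 0 < bFun g ψ x) {c : ℝ} (hc : 0 < c) :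
    qVec g ψ x mu c = 0 ↔ ∀ i, max (g i x) (-(mu i)) = 0 := by
  have hp : 0 < 1 / c * pFun g ψ x mu := by
    unfold pFun
    positivity
  have h : ∀ i, qVec g ψ x mu c i = max (g i x) (-(1 / c * pFun g ψ x mu * mu i)) := fun i => by
    simp [qVec, neg_mul]
  constructor
  · intro h0 i
    rw [← max_neg_eq_zero_iff_mul hp, ← h, h0]
    rfl
  · intro h0
    ext i
    rw [h, PiLp.zero_apply]
    exact (max_neg_eq_zero_iff_mul hp).2 (h0 i)

/-- At a KKT-point the augmented Lagrangian coincides with the objective function. -/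
theorem IsKKT.augLagrangian_eq {f : X → ℝ} {F : X → H} {g : Fin m → X → ℝ} {φ : ℝ≥0 → ℝ≥0∞}
    {ψ : Rm m → ℝ} (hφ : IsPenaltyFun φ) (hψ : IsBarrierFun ψ)
    {x : X} {lam : H} {mu : Rm m} (h : IsKKT f F g x lam mu) {c : ℝ} (hc : 0 < c) :
    augLagrangian f F g φ ψ c (x, lam, mu) = (f x : EReal) := by
  have hg0 : ∀ i, g i x ≤ 0 := fun i => h.2.2 i ▸ le_max_left _ _
  have hgp : gPlus g x = 0 := by
    ext i
    simpa [gPlus] using hg0 i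
  have hb : 0 < bFun g ψ x := by rw [bFun, hgp]; exact hψ.pos
  have hφ0 : φ 0 = 0 := (hφ.eq_zero_iff 0).2 rfl
  have hΩ : x ∈ Omega F g φ ψ := ⟨hb, by simp [h.2.1, hφ0]⟩
  have hmul : ∀ i, g i x * mu i = 0 := by
    intro i
    rcases max_choice (g i x) (-(mu i)) with h4 | h4 <;> rw [h.2.2 i] at h4
    · simp [← h4]
    · simp [neg_eq_zero.1 h4.symm]
  have heta : eta f F g x lam mu = 0 := by
    have h5 : ∀ i, g i x ^ 2 * mu i = 0 := fun i => by rw [sq, mul_assoc, hmul, mul_zero]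
    simp [eta, h.1, h5]
  rw [augLagrangian, if_pos hΩ, augLagrangianReal, (qVec_eq_zero_iff hb hc).2 h.2.2, heta, h.2.1]
  simp [hφ0]

/-! ### Convexity estimates for φ -/

section Penalty

variable {φ : ℝ≥0 → ℝ≥0∞}

theorem zero_mem_phiDom (hφ : IsPenaltyFun φ) : (0 : ℝ) ∈ phiDom φ :=
  ⟨le_rfl, by simp [(hφ.eq_zero_iff 0).2 rfl]⟩

theorem phiReal_zero (hφ : IsPenaltyFun φ) : phiReal φ 0 = 0 := by
  simp [phiReal, (hφ.eq_zero_iff 0).2 rfl]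

theorem mem_phiDom_of_le (hφ : IsPenaltyFun φ) {s t : ℝ} (ht : t ∈ phiDom φ) (hs : 0 ≤ s)
    (hst : s ≤ t) : s ∈ phiDom φ :=
  ⟨hs, (hφ.mono (Real.toNNReal_le_toNNReal hst)).trans_lt ht.2⟩

theorem exists_pos_mem_phiDom (hφ : IsPenaltyFun φ) : ∃ t, 0 < t ∧ t ∈ phiDom φ := by
  obtain ⟨t, ht, h⟩ := hφ.dom_ne
  exact ⟨t, by positivity, t.2, by simpa using h⟩

/-- Convexity along the segment from the origin, where φ vanishes. -/
theorem phiReal_mul_le (hφ : IsPenaltyFun φ) {s t : ℝ} (hs : 0 ≤ s) (hs1 : s ≤ 1)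
    (ht : t ∈ phiDom φ) : phiReal φ (s * t) ≤ s * phiReal φ t := by
  lift s to ℝ≥0 using hs
  have hs1' : s ≤ 1 := by exact_mod_cast hs1
  have h := hφ.convex.2 (Set.mem_univ t.toNNReal) (Set.mem_univ 0) (zero_le (a := s))
    (zero_le (a := 1 - s)) (add_tsub_cancel_of_le hs1')
  simp only [smul_zero, add_zero, (hφ.eq_zero_iff 0).2 rfl, smul_eq_mul] at h
  have h2 : (↑s * t : ℝ).toNNReal = s * t.toNNReal := by
    rw [Real.toNNReal_mul s.coe_nonneg, Real.toNNReal_coe]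
  unfold phiReal
  rw [h2]
  have h3 := ENNReal.toReal_mono (by
    rw [ENNReal.smul_def, smul_eq_mul]
    exact ENNReal.mul_ne_top ENNReal.coe_ne_top ht.2.ne) h
  simpa [ENNReal.smul_def] using h3

theorem hasDerivWithinAt_phiReal (hφ1 : ContDiffOn ℝ 1 (phiReal φ) (phiDom φ)) {t : ℝ}
    (ht : t ∈ phiDom φ) :
    HasDerivWithinAt (phiReal φ) (derivWithin (phiReal φ) (phiDom φ) t) (phiDom φ) t :=
  ((hφ1.differentiableOn one_ne_zero) t ht).hasDerivWithinAt

/-- The function s φ(t) - φ(st) is nonnegative on [0, 1] and vanishes at s = 0, so its right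
derivative there is nonnegative. -/
theorem deriv_zero_mul_le_phiReal (hφ : IsPenaltyFun φ)
    (hφ1 : ContDiffOn ℝ 1 (phiReal φ) (phiDom φ)) {t : ℝ} (ht : t ∈ phiDom φ) :
    derivWithin (phiReal φ) (phiDom φ) 0 * t ≤ phiReal φ t := by
  have h1 := hasDerivWithinAt_phiReal hφ1 (zero_mem_phiDom hφ)
  have h2 : HasDerivWithinAt (fun s : ℝ => s * t) t (Set.Icc 0 1) 0 := by
    simpa using (hasDerivWithinAt_id (0 : ℝ) (Set.Icc 0 1)).mul_const t
  have hmaps : Set.MapsTo (fun s : ℝ => s * t) (Set.Icc 0 1) (phiDom φ) := fun s hs =>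
    mem_phiDom_of_le hφ ht (mul_nonneg hs.1 ht.1) (by nlinarith [hs.2, ht.1])
  have h3 : HasDerivWithinAt (fun s : ℝ => s * phiReal φ t - phiReal φ (s * t))
      (phiReal φ t - derivWithin (phiReal φ) (phiDom φ) 0 * t) (Set.Icc 0 1) 0 := by
    rw [← zero_mul t] at h1
    have h4 := HasDerivWithinAt.comp (0 : ℝ) h1 h2 hmaps
    rw [zero_mul] at h4
    have h6 := ((hasDerivWithinAt_id (0 : ℝ) (Set.Icc 0 1)).mul_const (phiReal φ t)).sub h4
    rw [one_mul] at h6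
    exact h6
  have h5 := nonneg_of_hasDerivWithinAt_of_eventually_le
    (h3.mono_of_mem_nhdsWithin (Icc_mem_nhdsGT zero_lt_one)) (by
      filter_upwards [Icc_mem_nhdsGT zero_lt_one] with s hs
      have := phiReal_mul_le hφ hs.1 hs.2 ht
      simp only [zero_mul, phiReal_zero hφ]
      linarith)
  linarith

/-- The chord slope φ(t)/t lies between the two derivatives. Differentiating (1 - s) φ(t) - φ((1 -
s)t) at s = 0 approaches t from the left, so t may be the right endpoint of the domain. -/
theorem deriv_zero_le_deriv_phiReal (hφ : IsPenaltyFun φ)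
    (hφ1 : ContDiffOn ℝ 1 (phiReal φ) (phiDom φ)) {t : ℝ} (ht : t ∈ phiDom φ) :
    derivWithin (phiReal φ) (phiDom φ) 0 ≤ derivWithin (phiReal φ) (phiDom φ) t := by
  rcases ht.1.eq_or_lt with rfl | htpos
  · exact le_rfl
  have h1 := hasDerivWithinAt_phiReal hφ1 ht
  have h0 : HasDerivWithinAt (fun s : ℝ => 1 - s) (-1) (Set.Icc 0 1) 0 := by
    simpa using (hasDerivWithinAt_id (0 : ℝ) (Set.Icc 0 1)).const_sub 1
  have h2 : HasDerivWithinAt (fun s : ℝ => (1 - s) * t) (-1 * t) (Set.Icc 0 1) 0 :=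
    h0.mul_const t
  have hmaps : Set.MapsTo (fun s : ℝ => (1 - s) * t) (Set.Icc 0 1) (phiDom φ) := fun s hs =>
    mem_phiDom_of_le hφ ht (mul_nonneg (by linarith [hs.2]) ht.1) (by nlinarith [hs.1, ht.1])
  have h3 : HasDerivWithinAt (fun s : ℝ => (1 - s) * phiReal φ t - phiReal φ ((1 - s) * t))
      (-1 * phiReal φ t - derivWithin (phiReal φ) (phiDom φ) t * (-1 * t)) (Set.Icc 0 1) 0 := by
    have ht0 : t = (1 - 0) * t := by ring
    rw [ht0] at h1
    have h4 := HasDerivWithinAt.comp (0 : ℝ) h1 h2 hmaps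
    rw [← ht0] at h4
    exact (h0.mul_const (phiReal φ t)).sub h4
  have h5 := nonneg_of_hasDerivWithinAt_of_eventually_le
    (h3.mono_of_mem_nhdsWithin (Icc_mem_nhdsGT zero_lt_one)) (by
      filter_upwards [Icc_mem_nhdsGT zero_lt_one] with s hs
      have := phiReal_mul_le hφ (s := 1 - s) (by linarith [hs.2]) (by linarith [hs.1]) ht
      simp only [sub_zero, one_mul, sub_self]
      linarith)
  have h6 := deriv_zero_mul_le_phiReal hφ hφ1 ht
  exact le_of_mul_le_mul_right (by linarith) htpos

/-- Differentiability at 0 gives the linear bound. The inclusion of [0, τ] in the domain also serves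
to show that points with small F are interior to Ω. -/
theorem exists_phiReal_le (hφ : IsPenaltyFun φ) (hφ1 : ContDiffOn ℝ 1 (phiReal φ) (phiDom φ)) :
    ∃ τ C, 0 < τ ∧ 0 < C ∧ ∀ t, 0 ≤ t → t ≤ τ → t ∈ phiDom φ ∧ phiReal φ t ≤ C * t := by
  obtain ⟨T, hT, hTd⟩ := exists_pos_mem_phiDom hφ
  have hsub : Set.Icc 0 T ⊆ phiDom φ := fun s hs => mem_phiDom_of_le hφ hTd hs.1 hs.2
  have h1 := (hasDerivWithinAt_phiReal hφ1 (zero_mem_phiDom hφ)).mono hsub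
  set κ := derivWithin (phiReal φ) (phiDom φ) 0
  have h2 := h1.isLittleO.bound one_pos
  rw [eventually_nhdsWithin_iff, Metric.eventually_nhds_iff] at h2
  obtain ⟨δ, hδ, h2⟩ := h2
  refine ⟨min (δ / 2) T, |κ| + 1, by positivity, by positivity, fun t ht htτ => ?_⟩
  have htT : t ≤ T := htτ.trans (min_le_right _ _)
  have htδ : t ≤ δ / 2 := htτ.trans (min_le_left _ _)
  refine ⟨hsub ⟨ht, htT⟩, ?_⟩
  have h3 := h2 (y := t) (by rw [dist_zero_right, Real.norm_eq_abs, abs_of_nonneg ht]; linarith)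
    ⟨ht, htT⟩
  simp only [phiReal_zero hφ, sub_zero, smul_eq_mul, Real.norm_eq_abs, one_mul,
    abs_of_nonneg ht] at h3
  have h4 := (abs_le.1 h3).2
  have h5 : t * κ ≤ t * |κ| := mul_le_mul_of_nonneg_left (le_abs_self κ) ht
  simp at h4
  linarith

theorem toReal_phi_nnnorm (F : X → H) (x : X) :
    (φ (‖F x‖₊ ^ 2)).toReal = phiReal φ (‖F x‖ ^ 2) := by
  rw [phiReal, Real.toNNReal_pow (norm_nonneg _), norm_toNNReal]

theorem phi_lt_top_iff (F : X → H) (x : X) :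
    φ (‖F x‖₊ ^ 2) < ⊤ ↔ ‖F x‖ ^ 2 ∈ phiDom φ := by
  have : (‖F x‖ ^ 2).toNNReal = ‖F x‖₊ ^ 2 := by
    rw [Real.toNNReal_pow (norm_nonneg _), norm_toNNReal]
  simp [phiDom, this]

/-- At F(x) = 0 the derivative of φ is only one-sided, but ‖F‖² maps a whole neighbourhood of x into
the domain, so the composition has a full derivative. -/
theorem hasFDerivAt_phi (hφ1 : ContDiffOn ℝ 1 (phiReal φ) (phiDom φ)) {F : X → H} {x : X}
    (hF : DifferentiableAt ℝ F x) (hx : ∀ᶠ y in 𝓝 x, ‖F y‖ ^ 2 ∈ phiDom φ) :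
    HasFDerivAt (fun y => phiReal φ (‖F y‖ ^ 2))
      (derivWithin (phiReal φ) (phiDom φ) (‖F x‖ ^ 2) •
        (2 • (innerSL ℝ (F x)).comp (fderiv ℝ F x))) x := by
  have h1 := hasDerivWithinAt_phiReal hφ1 hx.self_of_nhds
  have h2 := hF.hasFDerivAt.norm_sq
  have h3 := h1.comp_hasFDerivWithinAt x (s := {y | ‖F y‖ ^ 2 ∈ phiDom φ})
    h2.hasFDerivWithinAt (fun y hy => hy)
  exact h3.hasFDerivAt hx

end Penalty

/-! ### Differentiability and local bounds for the barrier b -/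

section Barrier

variable {ψ : Rm m → ℝ}

/-- The coordinatewise positive part. -/
def posPart (y : Rm m) : Rm m := WithLp.toLp 2 fun i => max (y i) 0

theorem posPart_mem (y : Rm m) : posPart y ∈ orthant m := fun _ => le_max_right _ _

theorem norm_le_mul_of_abs_le {y z : Rm m} {k : ℝ} (hk : 0 ≤ k) (h : ∀ i, |y i| ≤ k * |z i|) :
    ‖y‖ ≤ k * ‖z‖ := by
  refine abs_le_of_sq_le_sq' ?_ (by positivity) |>.2
  rw [mul_pow, EuclideanSpace.norm_sq_eq, EuclideanSpace.norm_sq_eq, Finset.mul_sum]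
  refine Finset.sum_le_sum fun i _ => ?_
  simp only [Real.norm_eq_abs]
  rw [← mul_pow]
  exact pow_le_pow_left₀ (abs_nonneg _) (h i) 2

theorem norm_posPart_sub_le (y z : Rm m) : ‖posPart y - posPart z‖ ≤ ‖y - z‖ := by
  have := norm_le_mul_of_abs_le (y := posPart y - posPart z) (z := y - z) zero_le_one fun i => by
    simpa [posPart] using abs_max_sub_max_le_abs (y i) (z i) 0
  simpa using this

/-- The kinks of the positive part are invisible to ψ. Near y it acts as the identity on coordinates
with yᵢ > 0, and in the others the partial derivative of ψ at `posPart y` vanishes. So the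
derivative of ψ cannot tell the increment of `posPart` from that of its argument. -/
theorem hasFDerivAt_comp_posPart (hψ : IsBarrierFun ψ) (y : Rm m) :
    HasFDerivAt (fun z => ψ (posPart z)) (fderivWithin ℝ ψ (orthant m) (posPart y)) y := by
  set L := fderivWithin ℝ ψ (orthant m) (posPart y) with hL
  have h1 : HasFDerivWithinAt ψ L (orthant m) (posPart y) :=
    ((hψ.contDiffOn.differentiableOn one_ne_zero) _ (posPart_mem y)).hasFDerivWithinAt
  have hbig : (fun z => posPart z - posPart y) =O[𝓝 y] fun z => z - y :=
    Asymptotics.isBigO_of_le _ fun z => norm_posPart_sub_le z y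
  have htend : Tendsto posPart (𝓝 y) (𝓝[orthant m] (posPart y)) := by
    refine tendsto_nhdsWithin_iff.2 ⟨?_, Eventually.of_forall posPart_mem⟩
    rw [tendsto_iff_norm_sub_tendsto_zero]
    refine squeeze_zero (fun _ => norm_nonneg _) (fun z => norm_posPart_sub_le z y) ?_
    rw [← tendsto_iff_norm_sub_tendsto_zero]
    exact tendsto_id
  have hlin : ∀ᶠ z in 𝓝 y, L (posPart z - posPart y) = L (z - y) := by
    have h2 : ∀ i, ∀ᶠ z : Rm m in 𝓝 y, 0 < y i → 0 < z i := by
      intro i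
      by_cases h : 0 < y i
      · have hc : Continuous fun z : Rm m => z i := by fun_prop
        filter_upwards [hc.continuousAt.eventually (lt_mem_nhds h)] with z hz _ using hz
      · exact Eventually.of_forall fun z h' => absurd h' h
    filter_upwards [eventually_all.2 h2] with z hz
    rw [← sub_eq_zero, ← map_sub]
    set w := posPart z - posPart y - (z - y) with hw
    have hsum : w = ∑ i, w i • (EuclideanSpace.single i 1 : Rm m) :=
      (sum_single_smul fun i => w i).symm
    rw [hsum, map_sum]
    refine Finset.sum_eq_zero fun i _ => ?_
    rw [map_smul]
    by_cases h : 0 < y i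
    · have h3 : w i = 0 := by
        simp [hw, posPart, max_eq_left h.le, max_eq_left (hz i h).le]
      rw [h3, zero_smul]
    · rw [hL, hψ.partial_eq_zero _ (posPart_mem y) i
        (by simpa [posPart] using not_lt.1 h), smul_zero]
  refine HasFDerivAt.of_isLittleO ?_
  have h4 := (h1.isLittleO.comp_tendsto htend).trans_isBigO hbig
  refine h4.congr' ?_ EventuallyEq.rfl
  filter_upwards [hlin] with z hz
  simp only [Function.comp_apply, hz]

theorem uniqueDiffOn_orthant : UniqueDiffOn ℝ (orthant m) := by
  refine uniqueDiffOn_convex ?_ ?_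
  · intro y hy z hz s t hs ht _ i
    have := hy i
    have := hz i
    simp only [PiLp.add_apply, PiLp.smul_apply, smul_eq_mul]
    positivity
  · refine ⟨WithLp.toLp 2 fun _ => 1, mem_interior.2 ⟨{y | ∀ i, 0 < y i}, fun y hy i => (hy i).le,
      ?_, fun i => by simp⟩⟩
    simp only [Set.ofPred_forall]
    exact isOpen_iInter_of_finite fun i => isOpen_lt continuous_const (by fun_prop)

/-- Near the origin of the orthant, `ψ` is bounded away from zero and its derivative is bounded. -/
theorem exists_barrier_bound (hψ : IsBarrierFun ψ) :
    ∃ δ C, 0 < δ ∧ 0 < C ∧ ∀ y ∈ orthant m, ‖y‖ ≤ δ →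
      ψ 0 / 2 ≤ ψ y ∧ ‖fderivWithin ℝ ψ (orthant m) y‖ ≤ C := by
  have h0 : (0 : Rm m) ∈ orthant m := fun i => le_rfl
  have h1 := hψ.contDiffOn.continuousOn 0 h0
  have h2 := (hψ.contDiffOn.continuousOn_fderivWithin uniqueDiffOn_orthant le_rfl 0 h0).norm
  have h3 := h1.eventually (lt_mem_nhds (half_lt_self hψ.pos))
  have h4 := h2.eventually (gt_mem_nhds (lt_add_one _))
  have h5 := h3.and h4
  rw [eventually_nhdsWithin_iff, Metric.eventually_nhds_iff] at h5
  obtain ⟨δ, hδ, h5⟩ := h5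
  refine ⟨δ / 2, ‖fderivWithin ℝ ψ (orthant m) 0‖ + 1, by positivity, by positivity,
    fun y hy hyδ => ?_⟩
  obtain ⟨h6, h7⟩ := h5 (y := y) (by rw [dist_zero_right]; linarith) hy
  exact ⟨h6.le, h7.le⟩

/-- The derivative of `b`. -/
theorem hasFDerivAt_bFun (hψ : IsBarrierFun ψ) {g : Fin m → X → ℝ} {x : X}
    (hg : ∀ i, DifferentiableAt ℝ (g i) x) :
    ∃ G' : X →L[ℝ] Rm m, (∀ v, G' v = gradG g x v) ∧ HasFDerivAt (gVec g) G' x ∧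
      HasFDerivAt (bFun g ψ) ((fderivWithin ℝ ψ (orthant m) (gPlus g x)).comp G') x := by
  have h : HasFDerivAt (gVec g) ((EuclideanSpace.equiv (Fin m) ℝ).symm.toContinuousLinearMap.comp
      (ContinuousLinearMap.pi fun i => fderiv ℝ (g i) x)) x :=
    (EuclideanSpace.equiv (Fin m) ℝ).symm.hasFDerivAt.comp x
      (hasFDerivAt_pi.2 fun i => (hg i).hasFDerivAt)
  refine ⟨_, fun v => ?_, h, (hasFDerivAt_comp_posPart hψ (gVec g x)).comp x h⟩
  ext i
  simp [gradG, inner_gradient_left]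

end Barrier

/-! ### Uniform bounds for the Jacobian -/

theorem norm_gradient (f : X → ℝ) (x : X) : ‖gradient f x‖ = ‖fderiv ℝ f x‖ := by
  rw [gradient, LinearIsometryEquiv.norm_map]

theorem jac_eq_sum {F : X → H} {g : Fin m → X → ℝ} (hF : Differentiable ℝ F)
    (hg : ∀ i, Differentiable ℝ (g i)) :
    jac F g = fun x => ContinuousLinearMap.compL ℝ X H (Mult H m) (embH H m) (fderiv ℝ F x)
      + ∑ i, ContinuousLinearMap.compL ℝ X ℝ (Mult H m) (embR H i) (fderiv ℝ (g i) x) := by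
  funext x
  rw [jac, conMap_eq_sum]
  exact (((embH H m).hasFDerivAt.comp x (hF x).hasFDerivAt).add
    (HasFDerivAt.fun_sum fun i _ => (embR H i).hasFDerivAt.comp x (hg i x).hasFDerivAt)).fderiv

/-- Serves twice: for the constraint map, which bounds J, and for J itself, which bounds its
derivative. -/
theorem exists_hasFDerivAt_add_sum {E Y U W ι : Type*} [Fintype ι] [NormedAddCommGroup E]
    [NormedSpace ℝ E] [NormedAddCommGroup Y] [NormedSpace ℝ Y] [NormedAddCommGroup U]
    [NormedSpace ℝ U] [NormedAddCommGroup W] [NormedSpace ℝ W] (A : Y →L[ℝ] W) (B : ι → U →L[ℝ] W)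
    {p : E → Y} {q : ι → E → U} {x : E} (hp : DifferentiableAt ℝ p x)
    (hq : ∀ i, DifferentiableAt ℝ (q i) x) {b : ℝ} {d : ι → ℝ} (hb : ‖fderiv ℝ p x‖ ≤ b)
    (hd : ∀ i, ‖fderiv ℝ (q i) x‖ ≤ d i) :
    ∃ J : E →L[ℝ] W, HasFDerivAt (fun x => A (p x) + ∑ i, B i (q i x)) J x ∧
      ‖J‖ ≤ ‖A‖ * b + ∑ i, ‖B i‖ * d i := by
  refine ⟨A.comp (fderiv ℝ p x) + ∑ i, (B i).comp (fderiv ℝ (q i) x),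
    (A.hasFDerivAt.comp x hp.hasFDerivAt).add
      (HasFDerivAt.fun_sum fun i _ => (B i).hasFDerivAt.comp x (hq i).hasFDerivAt),
    norm_add_le_of_le ?_ ?_⟩
  · exact (A.opNorm_comp_le _).trans (mul_le_mul_of_nonneg_left hb (norm_nonneg _))
  · exact norm_sum_le_of_le _ fun i _ => ((B i).opNorm_comp_le _).trans
      (mul_le_mul_of_nonneg_left (hd i) (norm_nonneg _))

/-- Bounds for the constraint map and its derivatives in terms of those for the components. -/
theorem exists_jac_bound {F : X → H} {g : Fin m → X → ℝ} (hF : Differentiable ℝ F)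
    (hg : ∀ i, Differentiable ℝ (g i)) {V : Set X} (hFB : BoundedC2On F V)
    (hgB : ∀ i, BoundedC2On (g i) V) :
    ∃ B, 0 < B ∧ ∀ x ∈ V, ‖jac F g x‖ ≤ B ∧ (∀ i, |g i x| ≤ B) ∧
      (∀ i, ‖fderiv ℝ (g i) x‖ ≤ B) ∧
      (DifferentiableAt ℝ (fderiv ℝ F) x → (∀ i, DifferentiableAt ℝ (fderiv ℝ (g i)) x) →
        ∃ J' : X →L[ℝ] X →L[ℝ] Mult H m, HasFDerivAt (jac F g) J' x ∧ ‖J'‖ ≤ B) := by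
  obtain ⟨BF, hBF⟩ := hFB
  choose Bg hBg using hgB
  set AF := ContinuousLinearMap.compL ℝ X H (Mult H m) (embH H m)
  set Ag : Fin m → ((X →L[ℝ] ℝ) →L[ℝ] (X →L[ℝ] Mult H m)) := fun i =>
    ContinuousLinearMap.compL ℝ X ℝ (Mult H m) (embR H i)
  have hsum : ∀ i, |Bg i| ≤ ∑ j, |Bg j| := fun i =>
    Finset.single_le_sum (f := fun j => |Bg j|) (fun j _ => abs_nonneg _) (Finset.mem_univ i)
  -- Absolute values are taken because the given bounds may be negative when `V` is empty.
  obtain ⟨B₁, hB₁, hjac⟩ : ∃ B₁, 0 ≤ B₁ ∧ ∀ x ∈ V, ‖jac F g x‖ ≤ B₁ := by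
    refine ⟨‖embH H m‖ * |BF| + ∑ i, ‖embR H i‖ * |Bg i|, by positivity, fun x hx => ?_⟩
    obtain ⟨J, hJ, hJb⟩ := exists_hasFDerivAt_add_sum (embH H m) (fun i => embR H i) (hF x)
      (fun i => hg i x) ((hBF x hx).2.1.trans (le_abs_self _))
      (fun i => (hBg i x hx).2.1.trans (le_abs_self _))
    rwa [jac, conMap_eq_sum, hJ.fderiv]
  have h2 : 0 ≤ ∑ i, |Bg i| := by positivity
  have h3 : 0 ≤ ‖AF‖ * |BF| + ∑ i, ‖Ag i‖ * |Bg i| := by positivity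
  refine ⟨B₁ + (‖AF‖ * |BF| + ∑ i, ‖Ag i‖ * |Bg i|) + ∑ i, |Bg i| + 1, by positivity,
    fun x hx => ⟨?_, fun i => ?_, fun i => ?_, fun h2F h2g => ?_⟩⟩
  · have := hjac x hx
    linarith
  · have := (hBg i x hx).1.trans ((le_abs_self _).trans (hsum i))
    rw [Real.norm_eq_abs] at this
    linarith
  · have := (hBg i x hx).2.1.trans ((le_abs_self _).trans (hsum i))
    linarith
  · obtain ⟨J, hJ, hJb⟩ := exists_hasFDerivAt_add_sum AF Ag h2F h2g
      ((hBF x hx).2.2.trans (le_abs_self _)) (fun i => (hBg i x hx).2.2.trans (le_abs_self _))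
    rw [← jac_eq_sum hF hg] at hJ
    exact ⟨J, hJ, hJb.trans (by linarith)⟩

/-! ### Lower bounds and uniform boundedness of sublevel sets -/

/-- Hence a bound on q controls the violation of the inequality constraints. -/
theorem norm_gPlus_le_norm_qVec (g : Fin m → X → ℝ) (ψ : Rm m → ℝ) (x : X) (mu : Rm m) (c : ℝ) :
    ‖gPlus g x‖ ≤ ‖qVec g ψ x mu c‖ := by
  have := norm_le_mul_of_abs_le (y := gPlus g x) (z := qVec g ψ x mu c) zero_le_one fun i => by
    rw [one_mul]
    show |max (g i x) 0| ≤ |max (g i x) _|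
    rw [abs_of_nonneg (le_max_right _ _)]
    exact max_le ((le_max_left _ _).trans (le_abs_self _)) (abs_nonneg _)
  simpa using this

theorem bFun_le {ψ : Rm m → ℝ} (hψ : IsBarrierFun ψ) (g : Fin m → X → ℝ) (x : X) :
    bFun g ψ x ≤ ψ 0 := hψ.max_zero _ (posPart_mem (gVec g x))

theorem half_div_pFun (g : Fin m → X → ℝ) (ψ : Rm m → ℝ) (x : X) (mu : Rm m) (c : ℝ) :
    c / (2 * pFun g ψ x mu) = c * (1 + ‖mu‖ ^ 2) / (2 * bFun g ψ x) := by
  unfold pFun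
  have h1 : (1 + ‖mu‖ ^ 2) ≠ 0 := by positivity
  rw [← mul_div_assoc, div_div_eq_mul_div]

/-- Lower bound for the augmented Lagrangian on its effective domain. -/
theorem augLagrangianReal_ge {f : X → ℝ} {F : X → H} {g : Fin m → X → ℝ} {φ : ℝ≥0 → ℝ≥0∞}
    {ψ : Rm m → ℝ} (hψ : IsBarrierFun ψ) {κ : ℝ} (hκ : 0 < κ)
    (hφκ : ∀ t ∈ phiDom φ, κ * t ≤ phiReal φ t) {c : ℝ} (hc : 0 < c) {x : X}
    (hx : x ∈ Omega F g φ ψ) (lam : H) (mu : Rm m) :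
    f x + c * (κ / 2) * ‖F x‖ ^ 2 + c / (2 * ψ 0) * ‖qVec g ψ x mu c‖ ^ 2
      - (1 / (2 * κ) + ψ 0 / 2) / c + eta f F g x lam mu ≤
      augLagrangianReal f F g φ ψ c x lam mu := by
  have hB := hψ.pos
  have hb := hx.1
  have h1 : -(‖lam‖ * ‖F x‖) ≤ inner ℝ lam (F x) :=
    (abs_le.1 (abs_real_inner_le_norm lam (F x))).1
  have h2 : -(‖mu‖ * ‖qVec g ψ x mu c‖) ≤ inner ℝ mu (qVec g ψ x mu c) :=
    (abs_le.1 (abs_real_inner_le_norm _ _)).1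
  have h3 := hφκ _ ((phi_lt_top_iff F x).1 hx.2)
  have h4 : c * (1 + ‖mu‖ ^ 2) / (2 * ψ 0) ≤ c * (1 + ‖mu‖ ^ 2) / (2 * bFun g ψ x) := by
    gcongr
    exact bFun_le hψ g x
  rw [augLagrangianReal, half_div_pFun, toReal_phi_nnnorm]
  set N := ‖F x‖
  set Q := ‖qVec g ψ x mu c‖
  set l := ‖lam‖
  set u := ‖mu‖
  have h5 : c / 2 * (1 + l ^ 2) * (κ * N ^ 2) ≤ c / 2 * (1 + l ^ 2) * phiReal φ (N ^ 2) := by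
    gcongr
  have h6 : c * (1 + u ^ 2) / (2 * ψ 0) * Q ^ 2 ≤ c * (1 + u ^ 2) / (2 * bFun g ψ x) * Q ^ 2 := by
    gcongr
  -- In the weight 1 + |λ|² the summand 1 keeps a pure penalty, while |λ|² absorbs the linear term
  -- by completing the square, at the cost 1/(2κc). The same is done for μ, at the cost ψ(0)/(2c).
  have h7 : 0 ≤ c / 2 * l ^ 2 * (κ * N ^ 2) - l * N + 1 / (2 * κ) / c := by
    have : c / 2 * l ^ 2 * (κ * N ^ 2) - l * N + 1 / (2 * κ) / c
        = (c * κ * (l * N) - 1) ^ 2 / (2 * κ * c) := by field_simp; ring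
    rw [this]; positivity
  have h8 : 0 ≤ c * u ^ 2 / (2 * ψ 0) * Q ^ 2 - u * Q + ψ 0 / 2 / c := by
    have : c * u ^ 2 / (2 * ψ 0) * Q ^ 2 - u * Q + ψ 0 / 2 / c
        = (c * (u * Q) - ψ 0) ^ 2 / (2 * ψ 0 * c) := by field_simp; ring
    rw [this]; positivity
  have h9 : c * (1 + u ^ 2) / (2 * ψ 0) * Q ^ 2 =
      c / (2 * ψ 0) * Q ^ 2 + c * u ^ 2 / (2 * ψ 0) * Q ^ 2 := by ring
  have h10 : (1 / (2 * κ) + ψ 0 / 2) / c = 1 / (2 * κ) / c + ψ 0 / 2 / c := by ring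
  rw [h9] at h6
  rw [h10]
  linarith

theorem eta_nonneg (f : X → ℝ) (F : X → H) (g : Fin m → X → ℝ) (x : X) (lam : H) (mu : Rm m) :
    0 ≤ eta f F g x lam mu := by
  unfold eta
  have : 0 ≤ ∑ i, (inner ℝ (gradient (g i) x) (gradLagrangian f F g x lam mu)
      + g i x ^ 2 * mu i) ^ 2 := Finset.sum_nonneg fun i _ => sq_nonneg _
  positivity

/-- For large `c` the points at which the augmented Lagrangian does not exceed the optimal value
satisfy uniform bounds. -/
theorem exists_sublevel_bound {f : X → ℝ} {F : X → H} {g : Fin m → X → ℝ} {φ : ℝ≥0 → ℝ≥0∞}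
    {ψ : Rm m → ℝ} (hψ : IsBarrierFun ψ) (hf : Differentiable ℝ f) (hF : Differentiable ℝ F)
    (hg : ∀ i, Differentiable ℝ (g i)) {κ : ℝ} (hκ : 0 < κ)
    (hφκ : ∀ t ∈ phiDom φ, κ * t ≤ phiReal φ t) {r ε fstar : ℝ} (hε : 0 < ε)
    (hfB : BoundedC2On f (OmegaSub f F g φ ψ r (fstar + ε)))
    (hFB : BoundedC2On F (OmegaSub f F g φ ψ r (fstar + ε)))
    (hgB : ∀ i, BoundedC2On (g i) (OmegaSub f F g φ ψ r (fstar + ε)))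
    {a : ℝ} (ha : 0 < a)
    (hQ : ∀ x ∈ OmegaSub f F g φ ψ r (fstar + ε), ∀ (lam : H) (mu : Rm m),
      a * (‖lam‖ ^ 2 + ‖mu‖ ^ 2) ≤ quadQ F g x lam mu) :
    ∃ c₀ K, 0 < c₀ ∧ 0 < K ∧ ∀ c, c₀ ≤ c → ∀ x ∈ Omega F g φ ψ, ∀ (lam : H) (mu : Rm m),
      augLagrangianReal f F g φ ψ c x lam mu ≤ fstar →
      x ∈ OmegaSub f F g φ ψ r (fstar + ε) ∧ ‖mult lam mu‖ ^ 2 ≤ K ∧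
      ‖kktRes f F g x (mult lam mu)‖ ^ 2 ≤ K ∧ c * ‖F x‖ ^ 2 ≤ K ∧
      c * ‖qVec g ψ x mu c‖ ^ 2 ≤ K := by
  obtain ⟨BJ, hBJ, hJ⟩ := exists_jac_bound hF hg hFB hgB
  obtain ⟨Bf, hBf⟩ := hfB
  have hB := hψ.pos
  -- `c * k` is a common lower bound for both penalty weights, `D / c` is the loss from completing
  -- squares, and `E` bounds f_* + D/c - f(x) when c ≥ 1.
  set k := min (κ / 2) (1 / (2 * ψ 0)) with hk
  have hkpos : 0 < k := by positivity
  set D := 1 / (2 * κ) + ψ 0 / 2 with hD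
  have hDpos : 0 < D := by positivity
  set E := |fstar| + D + |Bf| with hE
  have hEpos : 0 < E := by positivity
  -- c ≥ r/k lets the penalty dominate that of Ω_r, and c ≥ D/ε keeps the loss below ε. The second
  -- constant collects the bounds for c‖F‖² and c|q|², for A, and for z.
  refine ⟨max 1 (max (r / k) (D / ε)),
    E / k + 2 * E + (4 * E + 2 * (BJ * |Bf|) ^ 2) / (2 * a), by positivity, by positivity,
    fun c hc x hx lam mu hL => ?_⟩
  have hc1 : 1 ≤ c := (le_max_left _ _).trans hc
  have hcr : r ≤ c * k := by
    rw [← div_le_iff₀ hkpos]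
    exact ((le_max_left _ _).trans (le_max_right _ _)).trans hc
  have hcD : D / c ≤ ε := by
    rw [div_le_iff₀ (by linarith), ← div_le_iff₀' hε]
    exact ((le_max_right _ _).trans (le_max_right _ _)).trans hc
  have hc0 : 0 < c := by linarith
  have hlow := (augLagrangianReal_ge (f := f) hψ hκ hφκ hc0 hx lam mu).trans hL
  rw [← hD] at hlow
  have hη := eta_nonneg f F g x lam mu
  set N := ‖F x‖ with hN
  set Q := ‖qVec g ψ x mu c‖ with hQdef
  have h1 : c * k * N ^ 2 ≤ c * (κ / 2) * N ^ 2 := by gcongr; exact min_le_left _ _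
  have h2 : c * k * Q ^ 2 ≤ c / (2 * ψ 0) * Q ^ 2 := by
    have : c / (2 * ψ 0) = c * (1 / (2 * ψ 0)) := by ring
    rw [this]; gcongr; exact min_le_right _ _
  have hmem : x ∈ OmegaSub f F g φ ψ r (fstar + ε) := by
    refine ⟨hx, ?_⟩
    have h3 : r * (N ^ 2 + ‖gPlus g x‖ ^ 2) ≤ c * k * (N ^ 2 + Q ^ 2) := by
      gcongr
      exact norm_gPlus_le_norm_qVec g ψ x mu c
    linarith
  have hfx : -|Bf| ≤ f x := by
    have := (hBf x hmem).1
    rw [Real.norm_eq_abs] at this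
    have h3 := (abs_le.1 this).1
    have h4 := le_abs_self Bf
    linarith
  have hDc : D / c ≤ D := div_le_self hDpos.le hc1
  have hmain : c * k * N ^ 2 + c * k * Q ^ 2 + eta f F g x lam mu ≤ E := by
    have := le_abs_self fstar
    linarith
  have hN0 : 0 ≤ c * k * N ^ 2 := by positivity
  have hQ0 : 0 ≤ c * k * Q ^ 2 := by positivity
  have hA : ‖kktRes f F g x (mult lam mu)‖ ^ 2 ≤ 2 * E := by
    have := eta_eq (hf x) (hF x) (fun i => hg i x) lam mu
    linarith
  -- Since S z = A - J∇f has bounded right-hand side, the lower bound on S bounds z.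
  have hz : ‖mult lam mu‖ ^ 2 ≤ (4 * E + 2 * (BJ * |Bf|) ^ 2) / (2 * a) := by
    rw [le_div_iff₀ (by positivity)]
    have h3 := hQ x hmem lam mu
    rw [quadQ_eq (hF x) (fun i => hg i x), ← norm_mult_sq] at h3
    have h4 : ‖jac F g x (gradient f x)‖ ≤ BJ * |Bf| := by
      refine ((jac F g x).le_opNorm _).trans ?_
      rw [norm_gradient]
      gcongr
      · exact (hJ x hmem).1
      · exact (hBf x hmem).2.1.trans (le_abs_self _)
    have h5 : ‖gramOp F g x (mult lam mu)‖ ≤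
        ‖kktRes f F g x (mult lam mu)‖ + ‖jac F g x (gradient f x)‖ := by
      have : gramOp F g x (mult lam mu) =
          kktRes f F g x (mult lam mu) - jac F g x (gradient f x) := by
        rw [kktRes, add_sub_cancel_left]
      rw [this]
      exact norm_sub_le _ _
    have h6 : ‖gramOp F g x (mult lam mu)‖ ^ 2 ≤
        2 * ‖kktRes f F g x (mult lam mu)‖ ^ 2 + 2 * (BJ * |Bf|) ^ 2 := by
      have h7 : ‖gramOp F g x (mult lam mu)‖ ^ 2 ≤
          (‖kktRes f F g x (mult lam mu)‖ + BJ * |Bf|) ^ 2 := by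
        gcongr
        linarith
      have h8 := sq_nonneg (‖kktRes f F g x (mult lam mu)‖ - BJ * |Bf|)
      rw [sub_sq] at h8
      rw [add_sq] at h7
      linarith
    linarith
  have hz0 : 0 ≤ (4 * E + 2 * (BJ * |Bf|) ^ 2) / (2 * a) := by positivity
  have hEk : 0 ≤ E / k := by positivity
  refine ⟨hmem, by linarith, by linarith, ?_, ?_⟩
  · have : c * N ^ 2 ≤ E / k := by
      rw [le_div_iff₀ hkpos]; linarith
    linarith
  · have : c * Q ^ 2 ≤ E / k := by
      rw [le_div_iff₀ hkpos]; linarith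
    linarith

/-! ### Derivatives of the KKT residual and of η in x -/

/-- The Riesz isomorphism as a real-linear map. -/
def riesz (X : Type*) [NormedAddCommGroup X] [InnerProductSpace ℝ X] [CompleteSpace X] :
    (X →L[ℝ] ℝ) →L[ℝ] X :=
  LinearMap.mkContinuous
    { toFun := fun l => (InnerProductSpace.toDual ℝ X).symm l
      map_add' := fun l l' => map_add _ l l'
      map_smul' := fun c l => by simp } 1
    fun l => by simp

theorem inner_riesz (l : X →L[ℝ] ℝ) (v : X) : (inner ℝ (riesz X l) v : ℝ) = l v :=
  InnerProductSpace.toDual_symm_apply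

theorem norm_riesz (l : X →L[ℝ] ℝ) : ‖riesz X l‖ = ‖l‖ :=
  LinearIsometryEquiv.norm_map (InnerProductSpace.toDual ℝ X).symm l

/-- The right-hand side is a continuous linear image of the derivatives of f and G, so it can be
differentiated in x without differentiating an adjoint. -/
theorem gradient_add_adjoint_jac (f : X → ℝ) (F : X → H) (g : Fin m → X → ℝ) (x : X)
    (z : Mult H m) :
    gradient f x + ContinuousLinearMap.adjoint (jac F g x) z =
      riesz X (fderiv ℝ f x + (innerSL ℝ z).comp (jac F g x)) := by
  refine ext_inner_right ℝ fun v => ?_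
  rw [inner_add_left, inner_gradient_left, ContinuousLinearMap.adjoint_inner_left, inner_riesz]
  rfl

theorem norm_coordOp_le (i : Fin m) (z : Mult H m) : ‖coordOp H i z‖ ≤ ‖z‖ := by
  obtain ⟨l, u, rfl⟩ := exists_mult z
  rw [coordOp_mult, embR_apply, norm_smul]
  have h1 : ‖mult (0 : H) (EuclideanSpace.single i (1 : ℝ))‖ ≤ 1 :=
    (norm_mult_le _ _).trans (by simp)
  have h2 : ‖u i‖ ≤ ‖u‖ := PiLp.norm_apply_le u i
  have h3 := norm_snd_le l u
  nlinarith [norm_nonneg (u i), norm_nonneg (mult (0 : H) (EuclideanSpace.single i (1 : ℝ)))]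

/-- The derivative of the residual of the KKT system with respect to `x`. -/
theorem exists_hasFDerivAt_kktRes {f : X → ℝ} {F : X → H} {g : Fin m → X → ℝ} {x : X}
    (z : Mult H m) {B : ℝ} (hB : 0 ≤ B) (hf2 : DifferentiableAt ℝ (fderiv ℝ f) x)
    (hf1B : ‖fderiv ℝ f x‖ ≤ B) (hf2B : ‖fderiv ℝ (fderiv ℝ f) x‖ ≤ B)
    {J' : X →L[ℝ] X →L[ℝ] Mult H m} (hJ : HasFDerivAt (jac F g) J' x)
    (hJB : ‖jac F g x‖ ≤ B) (hJ'B : ‖J'‖ ≤ B) (hg : ∀ i, DifferentiableAt ℝ (g i) x)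
    (hgB : ∀ i, |g i x| ≤ B) (hg1B : ∀ i, ‖fderiv ℝ (g i) x‖ ≤ B) :
    ∃ A' : X →L[ℝ] Mult H m, HasFDerivAt (fun y => kktRes f F g y z) A' x ∧
      ∀ d, ‖A' d‖ ≤ (2 * B * (B + ‖z‖ * B) + m * (2 * B * B * ‖z‖)) * ‖d‖ := by
  have hrw : (fun y => kktRes f F g y z) = fun y =>
      jac F g y (riesz X (fderiv ℝ f y + (innerSL ℝ z).comp (jac F g y)))
        + ∑ i, g i y ^ 2 • coordOp H i z := by
    funext y
    rw [kktRes, gramOp_apply, ← add_assoc, ← map_add, gradient_add_adjoint_jac]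
    simp [slackOp]
  set Cz : (X →L[ℝ] Mult H m) →L[ℝ] (X →L[ℝ] ℝ) :=
    ContinuousLinearMap.compL ℝ X (Mult H m) ℝ (innerSL ℝ z) with hCz
  have hCzB : ∀ S, ‖Cz S‖ ≤ ‖z‖ * ‖S‖ := fun S => by
    refine (ContinuousLinearMap.opNorm_comp_le (innerSL ℝ z) S).trans ?_
    rw [innerSL_apply_norm]
  have hl : HasFDerivAt (fun y => fderiv ℝ f y + Cz (jac F g y))
      (fderiv ℝ (fderiv ℝ f) x + Cz.comp J') x :=
    hf2.hasFDerivAt.add (Cz.hasFDerivAt.comp x hJ)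
  have hr : HasFDerivAt (fun y => riesz X (fderiv ℝ f y + Cz (jac F g y)))
      ((riesz X).comp (fderiv ℝ (fderiv ℝ f) x + Cz.comp J')) x :=
    (riesz X).hasFDerivAt.comp x hl
  have hmain := hJ.clm_apply hr
  have hsl : HasFDerivAt (fun y => ∑ i, g i y ^ 2 • coordOp H i z)
      (∑ i, (((2 : ℕ) • g i x ^ (2 - 1)) • fderiv ℝ (g i) x).smulRight (coordOp H i z)) x :=
    HasFDerivAt.fun_sum fun i _ => ((hg i).hasFDerivAt.pow 2).smul_const _
  rw [hrw]
  refine ⟨_, hmain.add hsl, fun d => ?_⟩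
  have hl0 : ‖fderiv ℝ f x + Cz (jac F g x)‖ ≤ B + ‖z‖ * B :=
    norm_add_le_of_le hf1B ((hCzB _).trans (by gcongr))
  have hl1 : ‖fderiv ℝ (fderiv ℝ f) x d + Cz (J' d)‖ ≤ (B + ‖z‖ * B) * ‖d‖ := by
    have h1 : ‖fderiv ℝ (fderiv ℝ f) x d‖ ≤ B * ‖d‖ :=
      ContinuousLinearMap.le_of_opNorm_le _ hf2B d
    have h2 : ‖Cz (J' d)‖ ≤ ‖z‖ * (B * ‖d‖) :=
      (hCzB _).trans (by gcongr; exact ContinuousLinearMap.le_of_opNorm_le _ hJ'B d)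
    refine (norm_add_le_of_le h1 h2).trans (le_of_eq ?_)
    ring
  have h1 : ‖jac F g x (riesz X (fderiv ℝ (fderiv ℝ f) x d + Cz (J' d)))‖ ≤
      B * ((B + ‖z‖ * B) * ‖d‖) := by
    refine (ContinuousLinearMap.le_of_opNorm_le _ hJB _).trans ?_
    rw [norm_riesz]
    gcongr
  have h2 : ‖J' d (riesz X (fderiv ℝ f x + Cz (jac F g x)))‖ ≤
      B * ‖d‖ * (B + ‖z‖ * B) := by
    refine (ContinuousLinearMap.le_of_opNorm_le _
      (ContinuousLinearMap.le_of_opNorm_le _ hJ'B d) _).trans ?_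
    rw [norm_riesz]
    gcongr
  have h3 : ‖∑ i, (((2 : ℕ) • g i x ^ (2 - 1)) • fderiv ℝ (g i) x) d • coordOp H i z‖ ≤
      ∑ _i : Fin m, 2 * B * (B * ‖d‖) * ‖z‖ := by
    refine norm_sum_le_of_le _ fun i _ => ?_
    rw [norm_smul]
    gcongr
    · have h4 : ‖fderiv ℝ (g i) x d‖ ≤ B * ‖d‖ :=
        ContinuousLinearMap.le_of_opNorm_le _ (hg1B i) d
      have h5 : (((2 : ℕ) • g i x ^ (2 - 1)) • fderiv ℝ (g i) x) d
          = 2 * g i x * fderiv ℝ (g i) x d := by simp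
      rw [h5, norm_mul, norm_mul, Real.norm_eq_abs 2, abs_two]
      gcongr
      exact hgB i
    · exact norm_coordOp_le i z
  rw [Finset.sum_const, Finset.card_univ, Fintype.card_fin, nsmul_eq_mul] at h3
  have h6 := norm_add_le_of_le (norm_add_le_of_le h1 h2) h3
  simp only [add_apply, sum_apply, ContinuousLinearMap.smulRight_apply,
    ContinuousLinearMap.comp_apply, ContinuousLinearMap.flip_apply] at *
  refine h6.trans (le_of_eq ?_)
  ring

/-- The derivative is ⟨A, A' d⟩, so it vanishes together with the residual; this is why η perturbs
stationarity only by O(‖A‖). -/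
theorem exists_hasFDerivAt_eta {f : X → ℝ} {F : X → H} {g : Fin m → X → ℝ} {x : X}
    (hf : Differentiable ℝ f) (hF : Differentiable ℝ F) (hg : ∀ i, Differentiable ℝ (g i))
    (lam : H) (mu : Rm m) {C : ℝ} {A' : X →L[ℝ] Mult H m}
    (hA : HasFDerivAt (fun y => kktRes f F g y (mult lam mu)) A' x)
    (hA' : ∀ d, ‖A' d‖ ≤ C * ‖d‖) :
    ∃ η' : X →L[ℝ] ℝ, HasFDerivAt (fun y => eta f F g y lam mu) η' x ∧
      ∀ d, |η' d| ≤ ‖kktRes f F g x (mult lam mu)‖ * (C * ‖d‖) := by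
  have hrw : (fun y => eta f F g y lam mu) =
      fun y => 1 / 2 * ‖kktRes f F g y (mult lam mu)‖ ^ 2 :=
    funext fun y => eta_eq (hf y) (hF y) (fun i => hg i y) lam mu
  rw [hrw]
  refine ⟨_, hA.norm_sq.const_mul (1 / 2), fun d => ?_⟩
  have : ((1 / 2 : ℝ) • (2 • (innerSL ℝ (kktRes f F g x (mult lam mu))).comp A')) d =
      inner ℝ (kktRes f F g x (mult lam mu)) (A' d) := by
    simp
  rw [this]
  exact (abs_real_inner_le_norm _ _).trans (by gcongr; exact hA' d)

/-! ### Slack formulation and stationarity conditions -/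

/-- Completing the square: the vector `q` minimises the quadratic term over all slacks. -/
theorem max_quadratic_le {μ k γ t : ℝ} (hk : 0 < k) (ht : γ ≤ t) :
    μ * max γ (-(μ / k)) + k / 2 * max γ (-(μ / k)) ^ 2 ≤ μ * t + k / 2 * t ^ 2 := by
  rcases le_total γ (-(μ / k)) with h | h
  · rw [max_eq_right h]
    have h1 : μ * t + k / 2 * t ^ 2 - (μ * -(μ / k) + k / 2 * (-(μ / k)) ^ 2)
        = k / 2 * (t + μ / k) ^ 2 := by field_simp; ring
    have : 0 ≤ k / 2 * (t + μ / k) ^ 2 := by positivity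
    linarith
  · rw [max_eq_left h]
    have h2 : 0 ≤ μ + k * γ := by
      have : k * -(μ / k) ≤ k * γ := by gcongr
      have h3 : k * -(μ / k) = -μ := by field_simp
      linarith
    have h1 : μ * t + k / 2 * t ^ 2 - (μ * γ + k / 2 * γ ^ 2)
        = (t - γ) * (μ + k * γ) + k / 2 * (t - γ) ^ 2 := by ring
    have : 0 ≤ (t - γ) * (μ + k * γ) := mul_nonneg (by linarith) h2
    have : 0 ≤ k / 2 * (t - γ) ^ 2 := by positivity
    linarith

/-- The augmented Lagrangian with the slack variable `s` left free. -/
def slackLagrangian (f : X → ℝ) (F : X → H) (g : Fin m → X → ℝ) (φ : ℝ≥0 → ℝ≥0∞)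
    (ψ : Rm m → ℝ) (c : ℝ) (s : Rm m) (x : X) (lam : H) (mu : Rm m) : ℝ :=
  f x + inner ℝ lam (F x) + c / 2 * (1 + ‖lam‖ ^ 2) * phiReal φ (‖F x‖ ^ 2)
    + inner ℝ mu (gVec g x + s)
    + c * (1 + ‖mu‖ ^ 2) / 2 * (‖gVec g x + s‖ ^ 2 / bFun g ψ x) + eta f F g x lam mu

theorem qVec_apply (g : Fin m → X → ℝ) (ψ : Rm m → ℝ) (x : X) (mu : Rm m) (c : ℝ) (i : Fin m) :
    qVec g ψ x mu c i = max (g i x) (-(mu i / (c * (1 + ‖mu‖ ^ 2) / bFun g ψ x))) := by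
  have h1 : (1 + ‖mu‖ ^ 2) ≠ 0 := by positivity
  have : -(1 / c) * pFun g ψ x mu * mu i = -(mu i / (c * (1 + ‖mu‖ ^ 2) / bFun g ψ x)) := by
    rw [pFun, div_div_eq_mul_div, neg_mul, neg_mul, neg_inj, one_div, mul_comm c, ← div_div]
    ring
  rw [← this]
  rfl

/-- Together with equality at s = q - g, this makes the frozen-slack function a majorant that
touches the augmented Lagrangian at the point considered and contains no maximum. A minimiser of the
latter therefore minimises the former. -/
theorem augLagrangianReal_le_slackLagrangian (f : X → ℝ) (F : X → H) (g : Fin m → X → ℝ)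
    {φ : ℝ≥0 → ℝ≥0∞} {ψ : Rm m → ℝ} {c : ℝ} (hc : 0 < c) {s : Rm m} (hs : s ∈ orthant m)
    {x : X} (hx : x ∈ Omega F g φ ψ) (lam : H) (mu : Rm m) :
    augLagrangianReal f F g φ ψ c x lam mu ≤ slackLagrangian f F g φ ψ c s x lam mu := by
  have hb := hx.1
  have hk : 0 < c * (1 + ‖mu‖ ^ 2) / bFun g ψ x := by positivity
  rw [augLagrangianReal, slackLagrangian, half_div_pFun, toReal_phi_nnnorm]
  set k := c * (1 + ‖mu‖ ^ 2) / bFun g ψ x with hkdef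
  have h1 : c * (1 + ‖mu‖ ^ 2) / (2 * bFun g ψ x) = k / 2 := by rw [hkdef]; ring
  have h2 : c * (1 + ‖mu‖ ^ 2) / 2 * (‖gVec g x + s‖ ^ 2 / bFun g ψ x)
      = k / 2 * ‖gVec g x + s‖ ^ 2 := by rw [hkdef]; ring
  have h3 : inner ℝ mu (qVec g ψ x mu c) + k / 2 * ‖qVec g ψ x mu c‖ ^ 2 ≤
      inner ℝ mu (gVec g x + s) + k / 2 * ‖gVec g x + s‖ ^ 2 := by
    simp only [PiLp.inner_apply, EuclideanSpace.norm_sq_eq, Finset.mul_sum,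
      ← Finset.sum_add_distrib]
    refine Finset.sum_le_sum fun i _ => ?_
    rw [qVec_apply, ← hkdef]
    have h4 := max_quadratic_le (μ := mu i) (γ := g i x) (t := g i x + s i) hk
      (by linarith [hs i])
    simpa [gVec, mul_comm] using h4
  rw [h1, h2]
  linarith

theorem augLagrangianReal_eq_slackLagrangian (f : X → ℝ) (F : X → H) (g : Fin m → X → ℝ)
    (φ : ℝ≥0 → ℝ≥0∞) (ψ : Rm m → ℝ) (c : ℝ) (x : X) (lam : H) (mu : Rm m) :
    augLagrangianReal f F g φ ψ c x lam mu =
      slackLagrangian f F g φ ψ c (qVec g ψ x mu c - gVec g x) x lam mu := by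
  rw [augLagrangianReal, slackLagrangian, half_div_pFun, toReal_phi_nnnorm, add_sub_cancel]
  ring

theorem qVec_sub_gVec_mem (g : Fin m → X → ℝ) (ψ : Rm m → ℝ) (x : X) (mu : Rm m) (c : ℝ) :
    qVec g ψ x mu c - gVec g x ∈ orthant m := fun _ => sub_nonneg.2 (le_max_left _ _)

/-- The penalty part of the stationarity condition of the augmented Lagrangian. -/
def penVec (F : X → H) (g : Fin m → X → ℝ) (φ : ℝ≥0 → ℝ≥0∞) (ψ : Rm m → ℝ) (c : ℝ) (x : X)
    (lam : H) (mu : Rm m) : Mult H m :=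
  mult (((1 + ‖lam‖ ^ 2) * derivWithin (phiReal φ) (phiDom φ) (‖F x‖ ^ 2)) • F x)
    (((1 + ‖mu‖ ^ 2) / bFun g ψ x) • qVec g ψ x mu c)

/-- Stationarity of the augmented Lagrangian in `x`. -/
theorem stationary_primal {f : X → ℝ} {F : X → H} {g : Fin m → X → ℝ} {φ : ℝ≥0 → ℝ≥0∞}
    {ψ : Rm m → ℝ} (hψ : IsBarrierFun ψ) (hφ1 : ContDiffOn ℝ 1 (phiReal φ) (phiDom φ))
    (hf : Differentiable ℝ f) (hF : Differentiable ℝ F) (hg : ∀ i, Differentiable ℝ (g i))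
    {c : ℝ} (hc : 0 < c) {x : X} {lam : H} {mu : Rm m} (hΩ : Omega F g φ ψ ∈ 𝓝 x)
    (hmin : ∀ y ∈ Omega F g φ ψ,
      augLagrangianReal f F g φ ψ c x lam mu ≤ augLagrangianReal f F g φ ψ c y lam mu)
    {η' : X →L[ℝ] ℝ} (hη : HasFDerivAt (fun y => eta f F g y lam mu) η' x) (d : X) :
    (inner ℝ (gradLagrangian f F g x lam mu
        + c • ContinuousLinearMap.adjoint (jac F g x) (penVec F g φ ψ c x lam mu)) d : ℝ) =
      c * (1 + ‖mu‖ ^ 2) / (2 * bFun g ψ x ^ 2) * ‖qVec g ψ x mu c‖ ^ 2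
        * fderivWithin ℝ ψ (orthant m) (gPlus g x) (gradG g x d) - η' d := by
  have hx : x ∈ Omega F g φ ψ := mem_of_mem_nhds hΩ
  have hb := hx.1
  -- The slack is optimal at the minimiser and stays fixed while x varies.
  set s := qVec g ψ x mu c - gVec g x with hs
  have hq : gVec g x + s = qVec g ψ x mu c := by rw [hs, add_sub_cancel]
  have hloc : IsLocalMin (fun y => slackLagrangian f F g φ ψ c s y lam mu) x := by
    filter_upwards [hΩ] with y hy
    rw [← augLagrangianReal_eq_slackLagrangian]
    exact (hmin y hy).trans
      (augLagrangianReal_le_slackLagrangian f F g hc (qVec_sub_gVec_mem g ψ x mu c) hy lam mu)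
  obtain ⟨G', hG', hgv, hbd⟩ := hasFDerivAt_bFun hψ (x := x) (fun i => hg i x)
  have hφd := hasFDerivAt_phi hφ1 (hF x) (by
    filter_upwards [hΩ] with y hy using (phi_lt_top_iff F y).1 hy.2)
  have h1 := (innerSL ℝ lam).hasFDerivAt.comp x (hF x).hasFDerivAt
  have hgs := hgv.add_const s
  have h2 := (innerSL ℝ mu).hasFDerivAt.comp x hgs
  have h3 := hgs.norm_sq.mul ((hasDerivAt_inv hb.ne').comp_hasFDerivAt x hbd)
  have hall := (((((hf x).hasFDerivAt.add h1).add
    (hφd.const_mul (c / 2 * (1 + ‖lam‖ ^ 2)))).add h2).add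
    (h3.const_mul (c * (1 + ‖mu‖ ^ 2) / 2))).add hη
  have hzero := hloc.hasFDerivAt_eq_zero hall
  have hd := congrArg (fun L : X →L[ℝ] ℝ => L d) hzero
  simp only [add_apply, smul_apply, ContinuousLinearMap.comp_apply, innerSL_apply_apply, hG', hq,
    smul_eq_mul, zero_apply, nsmul_eq_mul] at hd
  rw [gradLagrangian_eq (hf x) (hF x) (fun i => hg i x), inner_add_left, inner_add_left,
    inner_gradient_left, inner_smul_left, ContinuousLinearMap.adjoint_inner_left,
    ContinuousLinearMap.adjoint_inner_left, jac_apply (hF x) (fun i => hg i x), penVec,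
    inner_mult, inner_mult, inner_smul_left, inner_smul_left]
  simp only [conj_trivial]
  simp only [Function.comp_apply, Nat.cast_ofNat] at hd
  linear_combination hd

theorem eq_zero_of_forall_quadratic_nonneg {p q : ℝ} (h : ∀ t : ℝ, 0 ≤ p * t + q * t ^ 2) :
    p = 0 := by
  by_contra hp
  have hpos : 0 < |q| + 1 := by positivity
  have h1 := h (-p / (|q| + 1))
  have h2 : p * (-p / (|q| + 1)) + q * (-p / (|q| + 1)) ^ 2
      = p ^ 2 / (|q| + 1) ^ 2 * (q - (|q| + 1)) := by field_simp; ring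
  rw [h2] at h1
  have h3 : 0 < p ^ 2 / (|q| + 1) ^ 2 := by positivity
  have h4 : q - (|q| + 1) < 0 := by linarith [le_abs_self q]
  linarith [mul_neg_of_pos_of_neg h3 h4]

theorem norm_add_smul_sq {E : Type*} [NormedAddCommGroup E] [InnerProductSpace ℝ E] (v w : E)
    (t : ℝ) : ‖v + t • w‖ ^ 2 = ‖v‖ ^ 2 + 2 * inner ℝ v w * t + ‖w‖ ^ 2 * t ^ 2 := by
  rw [norm_add_sq_real, inner_smul_right, norm_smul, mul_pow, Real.norm_eq_abs, sq_abs]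
  ring

/-- Stationarity of the augmented Lagrangian in the multipliers. -/
theorem stationary_dual {f : X → ℝ} {F : X → H} {g : Fin m → X → ℝ} {φ : ℝ≥0 → ℝ≥0∞}
    {ψ : Rm m → ℝ} (hf : Differentiable ℝ f) (hF : Differentiable ℝ F)
    (hg : ∀ i, Differentiable ℝ (g i))
    {c : ℝ} (hc : 0 < c) {x : X} {lam : H} {mu : Rm m} (hx : x ∈ Omega F g φ ψ)
    (hmin : ∀ (l : H) (u : Rm m),
      augLagrangianReal f F g φ ψ c x lam mu ≤ augLagrangianReal f F g φ ψ c x l u) :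
    gramOp F g x (kktRes f F g x (mult lam mu)) =
      -mult (F x + (c * phiReal φ (‖F x‖ ^ 2)) • lam)
        (qVec g ψ x mu c + (c / bFun g ψ x * ‖qVec g ψ x mu c‖ ^ 2) • mu) := by
  refine ext_inner_right ℝ fun w => ?_
  obtain ⟨l, u, rfl⟩ := exists_mult w
  rw [gramOp_symm, inner_neg_left, inner_mult, eq_neg_iff_add_eq_zero]
  set A := kktRes f F g x (mult lam mu) with hA
  set q := qVec g ψ x mu c with hq
  set b := bFun g ψ x
  set P := phiReal φ (‖F x‖ ^ 2)
  -- With x and the slack frozen, the function is an exact quadratic polynomial in t along a ray of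
  -- multipliers, since the residual is affine. Minimality at t = 0 forces the linear coefficient to
  -- vanish.
  have key : ∀ t : ℝ, 0 ≤ (inner ℝ A (gramOp F g x (mult l u))
      + (inner ℝ (F x + (c * P) • lam) l + inner ℝ (q + (c / b * ‖q‖ ^ 2) • mu) u)) * t
      + (c / 2 * ‖l‖ ^ 2 * P + c * ‖u‖ ^ 2 / 2 * (‖q‖ ^ 2 / b)
        + 1 / 2 * ‖gramOp F g x (mult l u)‖ ^ 2) * t ^ 2 := by
    intro t
    have h1 := (hmin (lam + t • l) (mu + t • u)).trans
      (augLagrangianReal_le_slackLagrangian f F g hc (qVec_sub_gVec_mem g ψ x mu c) hx _ _)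
    rw [augLagrangianReal_eq_slackLagrangian] at h1
    have h2 : kktRes f F g x (mult (lam + t • l) (mu + t • u)) =
        A + t • gramOp F g x (mult l u) := by
      rw [mult_add, mult_smul, kktRes, map_add, map_smul, ← add_assoc, hA, kktRes]
    simp only [slackLagrangian, add_sub_cancel, eta_eq (hf x) (hF x) (fun i => hg i x), h2,
      norm_add_smul_sq, inner_add_left, inner_smul_left, conj_trivial] at h1 ⊢
    rw [← hA, ← hq] at h1
    rw [real_inner_comm l (F x), real_inner_comm u q]
    linear_combination h1
  exact eq_zero_of_forall_quadratic_nonneg key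

/-! ### Quantitative estimates forcing the residuals to vanish -/

/-- The elementary estimate that closes the argument: for large `c` the stationarity conditions
force all residuals to vanish. -/
theorem exists_threshold {s K K₁ K₂ K₃ : ℝ} (hs : 0 < s) (hK : 0 < K) (hK₁ : 0 < K₁)
    (hK₂ : 0 < K₂) (hK₃ : 0 < K₃) :
    ∃ c₁ : ℝ, 0 < c₁ ∧ ∀ c, c₁ ≤ c → ∀ α Y N δ : ℝ, 0 ≤ α → 0 ≤ Y → 0 ≤ N → 0 ≤ δ →
      c * δ ^ 2 ≤ K → α ^ 2 ≤ K → s * (c * Y) ≤ K₁ * α + K₁ * δ * (c * Y) → N ≤ K₃ * Y →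
      s * α ≤ K₂ * (N + c * N ^ 2) → α = 0 ∧ Y = 0 := by
  -- c ≥ K P² gives Pδ ≤ 1, that is K₁δ ≤ s/2; the last term of the primal estimate is then
  -- absorbed, leaving c Y ≤ P α.
  set P := 2 * K₁ / s with hP
  have hPpos : 0 < P := by positivity
  set M := K₂ * (1 + K₃ * P * (K + 1)) * (K₃ * P) / s with hM
  have hMpos : 0 < M := by positivity
  refine ⟨K * P ^ 2 + M + 1, by positivity, ?_⟩
  intro c hc α Y N δ hα hY hN hδ hcδ hαK h1 h2 h3
  have hKP : 0 < K * P ^ 2 := by positivity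
  have hc0 : 0 < c := by linarith
  have hδP : P * δ ≤ 1 := by
    refine abs_le_of_sq_le_sq' ?_ zero_le_one |>.2
    have h5 : K * (P * δ) ^ 2 ≤ K * 1 := by
      calc K * (P * δ) ^ 2 = K * P ^ 2 * δ ^ 2 := by ring
        _ ≤ c * δ ^ 2 := by gcongr; linarith
        _ ≤ K * 1 := by linarith
    rw [one_pow]
    exact le_of_mul_le_mul_left h5 hK
  have hcY : c * Y ≤ P * α := by
    have h5 : K₁ * δ ≤ s / 2 := by
      have : K₁ * δ = s / 2 * (P * δ) := by rw [hP]; field_simp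
      rw [this]
      nlinarith
    have h6 : K₁ * δ * (c * Y) ≤ s / 2 * (c * Y) := by gcongr
    rw [hP, div_mul_eq_mul_div, le_div_iff₀ hs]
    linarith
  have hα1 : α ≤ K + 1 := by nlinarith
  have hcN : c * N ≤ K₃ * P * α := by
    calc c * N ≤ c * (K₃ * Y) := by gcongr
      _ = K₃ * (c * Y) := by ring
      _ ≤ K₃ * (P * α) := by gcongr
      _ = K₃ * P * α := by ring
  have h6 : s * α ≤ K₂ * (1 + K₃ * P * (K + 1)) * N := by
    calc s * α ≤ K₂ * (N + c * N ^ 2) := h3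
      _ = K₂ * (1 + c * N) * N := by ring
      _ ≤ K₂ * (1 + K₃ * P * α) * N := by gcongr
      _ ≤ K₂ * (1 + K₃ * P * (K + 1)) * N := by gcongr
  -- Inserting c N ≤ K₃ P α into the dual estimate gives c α ≤ M α, and c > M leaves only α = 0.
  have h7 : c * α ≤ M * α := by
    have h8 : c * (s * α) ≤ K₂ * (1 + K₃ * P * (K + 1)) * (K₃ * P * α) := by
      calc c * (s * α) ≤ c * (K₂ * (1 + K₃ * P * (K + 1)) * N) := by gcongr
        _ = K₂ * (1 + K₃ * P * (K + 1)) * (c * N) := by ring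
        _ ≤ _ := by gcongr
    have h9 : M * α = K₂ * (1 + K₃ * P * (K + 1)) * (K₃ * P * α) / s := by rw [hM]; ring
    rw [h9, le_div_iff₀ hs]
    linarith
  have hα0 : α = 0 := by nlinarith
  refine ⟨hα0, ?_⟩
  rw [hα0, mul_zero] at hcY
  nlinarith

/-- The slack operator applied to the full multiplier estimate is of second order in `q`. -/
theorem norm_slackOp_le {g : Fin m → X → ℝ} {x : X} {q mu : Rm m} {k : ℝ} (hk : 0 < k)
    (hq : ∀ i, q i = max (g i x) (-(mu i / k))) (lam : H) :
    ‖slackOp H g x (mult lam (mu + k • q))‖ ≤ ‖q‖ * (‖mu‖ + k * ‖q‖) * ‖q‖ := by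
  rw [slackOp_mult]
  refine (norm_mult_le _ _).trans ?_
  rw [norm_zero, zero_add]
  refine norm_le_mul_of_abs_le (by positivity) fun i => ?_
  have hqi : |q i| ≤ ‖q‖ := PiLp.norm_apply_le q i
  have hmi : |mu i| ≤ ‖mu‖ := PiLp.norm_apply_le mu i
  simp only [diagSq, PiLp.add_apply, PiLp.smul_apply, smul_eq_mul]
  -- Either gᵢ = qᵢ, so that gᵢ² is quadratic in q, or qᵢ = -μᵢ/k and the i-th component of μ + k q
  -- is zero.
  rcases max_choice (g i x) (-(mu i / k)) with h | h <;> rw [← hq] at h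
  · rw [← h, abs_mul, abs_pow]
    have h1 : |mu i + k * q i| ≤ ‖mu‖ + k * ‖q‖ := by
      refine (abs_add_le _ _).trans ?_
      rw [abs_mul, abs_of_pos hk]
      gcongr
    calc |q i| ^ 2 * |mu i + k * q i| = |q i| * |mu i + k * q i| * |q i| := by ring
      _ ≤ ‖q‖ * (‖mu‖ + k * ‖q‖) * |q i| := by gcongr
  · have : mu i + k * q i = 0 := by rw [h]; field_simp; ring
    rw [this, mul_zero, abs_zero]
    positivity

theorem gramOp_bounded_below {F : X → H} {g : Fin m → X → ℝ} {x : X} {a : ℝ} (ha : 0 < a)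
    (hF : DifferentiableAt ℝ F x) (hg : ∀ i, DifferentiableAt ℝ (g i) x)
    (hQ : ∀ (lam : H) (mu : Rm m), a * (‖lam‖ ^ 2 + ‖mu‖ ^ 2) ≤ quadQ F g x lam mu)
    (z : Mult H m) : √(2 * a) * ‖z‖ ≤ ‖gramOp F g x z‖ := by
  obtain ⟨l, u, rfl⟩ := exists_mult z
  have h := hQ l u
  rw [quadQ_eq hF hg, ← norm_mult_sq] at h
  refine abs_le_of_sq_le_sq' ?_ (norm_nonneg _) |>.2
  rw [mul_pow, Real.sq_sqrt (by positivity)]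
  linarith

theorem norm_fst_penVec {F : X → H} {g : Fin m → X → ℝ} {φ : ℝ≥0 → ℝ≥0∞} {ψ : Rm m → ℝ} {κ : ℝ}
    {c : ℝ} {x : X} {lam : H} {mu : Rm m} (hκ : 0 < κ)
    (hκx : κ ≤ derivWithin (phiReal φ) (phiDom φ) (‖F x‖ ^ 2)) :
    ‖F x‖ ≤ 1 / κ * ‖penVec F g φ ψ c x lam mu‖ := by
  have h1 := norm_fst_le (((1 + ‖lam‖ ^ 2) * derivWithin (phiReal φ) (phiDom φ) (‖F x‖ ^ 2)) • F x)
    (((1 + ‖mu‖ ^ 2) / bFun g ψ x) • qVec g ψ x mu c)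
  rw [← penVec, norm_smul] at h1
  rw [one_div, ← div_eq_inv_mul, le_div_iff₀' hκ]
  refine le_trans ?_ h1
  gcongr
  refine le_trans ?_ (Real.le_norm_self _)
  nlinarith [sq_nonneg ‖lam‖]

theorem norm_snd_penVec {F : X → H} {g : Fin m → X → ℝ} {φ : ℝ≥0 → ℝ≥0∞} {ψ : Rm m → ℝ}
    {c : ℝ} {x : X} {lam : H} {mu : Rm m} :
    (1 + ‖mu‖ ^ 2) / bFun g ψ x * ‖qVec g ψ x mu c‖ ≤ ‖penVec F g φ ψ c x lam mu‖ := by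
  have h1 := norm_snd_le (((1 + ‖lam‖ ^ 2) * derivWithin (phiReal φ) (phiDom φ) (‖F x‖ ^ 2)) • F x)
    (((1 + ‖mu‖ ^ 2) / bFun g ψ x) • qVec g ψ x mu c)
  rw [← penVec, norm_smul] at h1
  refine le_trans ?_ h1
  gcongr
  exact Real.le_norm_self _

/-- The weight (1 + |μ|²)/b is at least 1/ψ(0), because 0 is a maximum point of ψ. -/
theorem norm_qVec_le_penVec {F : X → H} {g : Fin m → X → ℝ} {φ : ℝ≥0 → ℝ≥0∞} {ψ : Rm m → ℝ}
    (hψ : IsBarrierFun ψ) {c : ℝ} {x : X} {lam : H} {mu : Rm m} (hb : 0 < bFun g ψ x) :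
    ‖qVec g ψ x mu c‖ ≤ ψ 0 * ‖penVec F g φ ψ c x lam mu‖ := by
  have hB := hψ.pos
  have h1 := norm_snd_penVec (F := F) (φ := φ) (c := c) (g := g) (ψ := ψ) (x := x)
      (lam := lam) (mu := mu)
  rw [← div_le_iff₀' hB]
  refine le_trans ?_ h1
  rw [div_eq_inv_mul, ← one_div]
  gcongr
  · nlinarith [sq_nonneg ‖mu‖]
  · exact bFun_le hψ g x

/-- Stationarity in `x` bounds the penalty vector by the residual of the KKT system. -/
theorem primal_estimate {f : X → ℝ} {F : X → H} {g : Fin m → X → ℝ} {φ : ℝ≥0 → ℝ≥0∞}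
    {ψ : Rm m → ℝ} (hψ : IsBarrierFun ψ) (hf : Differentiable ℝ f) (hF : Differentiable ℝ F)
    (hg : ∀ i, Differentiable ℝ (g i)) {c : ℝ} (hc : 1 ≤ c) {x : X} {lam : H} {mu : Rm m}
    {a B K C₁ C₂ : ℝ} (hK : 0 ≤ K) (ha : 0 < a)
    (hQ : ∀ (lam : H) (mu : Rm m), a * (‖lam‖ ^ 2 + ‖mu‖ ^ 2) ≤ quadQ F g x lam mu)
    (hb : 0 < bFun g ψ x) (hJB : ‖jac F g x‖ ≤ B) (hz : ‖mult lam mu‖ ^ 2 ≤ K)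
    (hq : c * ‖qVec g ψ x mu c‖ ^ 2 ≤ K)
    (he : ‖gradLagrangian f F g x lam mu
        + c • ContinuousLinearMap.adjoint (jac F g x) (penVec F g φ ψ c x lam mu)‖ ≤
      C₁ * (c * ‖qVec g ψ x mu c‖ ^ 2) + C₂ * ‖kktRes f F g x (mult lam mu)‖)
    (hC₁ : 0 ≤ C₁) (hC₂ : 0 ≤ C₂) :
    √(2 * a) * (c * ‖penVec F g φ ψ c x lam mu‖) ≤
      (B * C₁ * ψ 0 + B * C₂ + 1 + (K + 1) * (ψ 0 + 1)) * ‖kktRes f F g x (mult lam mu)‖ +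
      (B * C₁ * ψ 0 + B * C₂ + 1 + (K + 1) * (ψ 0 + 1)) * ‖qVec g ψ x mu c‖
        * (c * ‖penVec F g φ ψ c x lam mu‖) := by
  have hB0 : 0 ≤ B := (norm_nonneg _).trans hJB
  have hψ0 := hψ.pos
  have hc0 : 0 < c := by linarith
  set q := qVec g ψ x mu c with hqdef
  set y := penVec F g φ ψ c x lam mu with hy
  set A := kktRes f F g x (mult lam mu) with hA
  set e := gradLagrangian f F g x lam mu + c • ContinuousLinearMap.adjoint (jac F g x) y with hedef
  set k := c * (1 + ‖mu‖ ^ 2) / bFun g ψ x with hk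
  have hkpos : 0 < k := by positivity
  -- The shifted multiplier z + c y has second component μ + k q, whose product with diag(gᵢ²) is of
  -- higher order in q.
  obtain ⟨l', hl'⟩ : ∃ l', mult lam mu + c • y = mult l' (mu + k • q) := by
    refine ⟨lam + c • (((1 + ‖lam‖ ^ 2) *
      derivWithin (phiReal φ) (phiDom φ) (‖F x‖ ^ 2)) • F x), ?_⟩
    rw [hy, penVec, ← mult_smul, ← mult_add, ← hqdef, hk, mul_div_assoc, ← smul_smul c _ q]
  -- J is applied to e = ∇L + c J* y and the slack of c y is added; J∇L is then eliminated through A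
  -- = J∇L + slack(z).
  have hid : gramOp F g x (c • y) =
      jac F g x e - A + slackOp H g x (mult l' (mu + k • q)) := by
    rw [hA, kktRes_eq (hf x) (hF x) (fun i => hg i x), hedef, ← hl', gramOp_apply]
    simp only [map_add, map_smul]
    abel
  have hδ : ‖q‖ ≤ ψ 0 * ‖y‖ := norm_qVec_le_penVec hψ hb
  have hkδ : k * ‖q‖ ≤ c * ‖y‖ := by
    have h1 := norm_snd_penVec (F := F) (φ := φ) (c := c) (g := g) (ψ := ψ) (x := x)
      (lam := lam) (mu := mu)
    rw [hk, mul_div_assoc, mul_assoc]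
    gcongr
  -- `K + 1` is a convenient upper bound for √K, used here and below.
  have hμ : ‖mu‖ ≤ K + 1 := by
    have := norm_snd_le lam mu
    nlinarith [norm_nonneg mu, norm_nonneg (mult lam mu)]
  have hqK : ‖q‖ ≤ K + 1 := by
    have : ‖q‖ ^ 2 ≤ c * ‖q‖ ^ 2 := le_mul_of_one_le_left (by positivity) hc
    nlinarith [norm_nonneg q]
  have hYc : ‖y‖ ≤ c * ‖y‖ := le_mul_of_one_le_left (norm_nonneg _) hc
  have hD : ‖slackOp H g x (mult l' (mu + k • q))‖ ≤
      ‖q‖ * (c * ‖y‖) * ((K + 1) * (ψ 0 + 1)) := by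
    refine (norm_slackOp_le hkpos (fun i => qVec_apply g ψ x mu c i) l').trans ?_
    calc ‖q‖ * (‖mu‖ + k * ‖q‖) * ‖q‖ = ‖q‖ * (‖mu‖ * ‖q‖ + (k * ‖q‖) * ‖q‖) := by ring
      _ ≤ ‖q‖ * ((K + 1) * (ψ 0 * (c * ‖y‖)) + (c * ‖y‖) * (K + 1)) := by
        gcongr
        exact hδ.trans (by gcongr)
      _ = _ := by ring
  have hT : ‖jac F g x e‖ ≤ B * (C₁ * (‖q‖ * (ψ 0 * (c * ‖y‖))) + C₂ * ‖A‖) := by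
    refine (ContinuousLinearMap.le_of_opNorm_le _ hJB e).trans ?_
    gcongr
    have hcq : c * ‖q‖ ^ 2 ≤ ‖q‖ * (ψ 0 * (c * ‖y‖)) := by
      calc c * ‖q‖ ^ 2 = ‖q‖ * (c * ‖q‖) := by ring
        _ ≤ ‖q‖ * (c * (ψ 0 * ‖y‖)) := by gcongr
        _ = _ := by ring
    exact he.trans (add_le_add_left (mul_le_mul_of_nonneg_left hcq hC₁) _)
  have hlow := gramOp_bounded_below ha (hF x) (fun i => hg i x) hQ (c • y)
  rw [norm_smul, Real.norm_eq_abs, abs_of_pos hc0, hid] at hlow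
  have hup := norm_add_le_of_le (norm_sub_le_of_le hT (le_refl ‖A‖)) hD
  -- Surplus terms that allow a single constant in front of both summands.
  have h1 : 0 ≤ (B * C₁ * ψ 0 + (K + 1) * (ψ 0 + 1)) * ‖A‖ := by positivity
  have h2 : 0 ≤ (B * C₂ + 1) * ‖q‖ * (c * ‖y‖) := by positivity
  refine (hlow.trans hup).trans ?_
  linarith

/-- Stationarity in the multipliers bounds the residual of the KKT system by the infeasibility. -/
theorem dual_estimate {f : X → ℝ} {F : X → H} {g : Fin m → X → ℝ} {φ : ℝ≥0 → ℝ≥0∞}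
    {ψ : Rm m → ℝ} (hψ : IsBarrierFun ψ) (hF : Differentiable ℝ F)
    (hg : ∀ i, Differentiable ℝ (g i)) {c : ℝ} (hc : 0 < c) {x : X} {lam : H} {mu : Rm m}
    {a K Cφ : ℝ} (hK : 0 ≤ K) (ha : 0 < a)
    (hQ : ∀ (lam : H) (mu : Rm m), a * (‖lam‖ ^ 2 + ‖mu‖ ^ 2) ≤ quadQ F g x lam mu)
    (hb : ψ 0 / 2 ≤ bFun g ψ x) (hz : ‖mult lam mu‖ ^ 2 ≤ K) (hCφ : 0 ≤ Cφ)
    (hφx : phiReal φ (‖F x‖ ^ 2) ≤ Cφ * ‖F x‖ ^ 2)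
    (hst : gramOp F g x (kktRes f F g x (mult lam mu)) =
      -mult (F x + (c * phiReal φ (‖F x‖ ^ 2)) • lam)
        (qVec g ψ x mu c + (c / bFun g ψ x * ‖qVec g ψ x mu c‖ ^ 2) • mu)) :
    √(2 * a) * ‖kktRes f F g x (mult lam mu)‖ ≤ (1 + Cφ * (K + 1) + 2 / ψ 0 * (K + 1)) *
      ((‖F x‖ + ‖qVec g ψ x mu c‖) + c * (‖F x‖ + ‖qVec g ψ x mu c‖) ^ 2) := by
  have hψ0 := hψ.pos
  have hb0 : 0 < bFun g ψ x := by linarith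
  have hlow := gramOp_bounded_below ha (hF x) (fun i => hg i x) hQ (kktRes f F g x (mult lam mu))
  rw [hst, norm_neg] at hlow
  refine hlow.trans ((norm_mult_le _ _).trans ?_)
  set q := qVec g ψ x mu c
  set N := ‖F x‖
  have hP0 : 0 ≤ phiReal φ (N ^ 2) := ENNReal.toReal_nonneg
  have hzK : ‖mult lam mu‖ ≤ K + 1 := by nlinarith [norm_nonneg (mult lam mu)]
  have hl := (norm_fst_le lam mu).trans hzK
  have hμ := (norm_snd_le lam mu).trans hzK
  have h1 : ‖F x + (c * phiReal φ (N ^ 2)) • lam‖ ≤ N + c * (Cφ * N ^ 2) * (K + 1) := by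
    refine norm_add_le_of_le le_rfl ?_
    rw [norm_smul, Real.norm_eq_abs, abs_of_nonneg (by positivity)]
    gcongr
  have h2 : ‖q + (c / bFun g ψ x * ‖q‖ ^ 2) • mu‖ ≤ ‖q‖ + c * (2 / ψ 0) * ‖q‖ ^ 2 * (K + 1) := by
    refine norm_add_le_of_le le_rfl ?_
    rw [norm_smul, Real.norm_eq_abs, abs_of_nonneg (by positivity)]
    have h3 : c / bFun g ψ x ≤ c * (2 / ψ 0) := by
      calc c / bFun g ψ x ≤ c / (ψ 0 / 2) := by gcongr
        _ = _ := by field_simp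
    gcongr
  have hN : 0 ≤ N := norm_nonneg _
  have hq0 : 0 ≤ ‖q‖ := norm_nonneg _
  have h3 : N ^ 2 ≤ (N + ‖q‖) ^ 2 := by gcongr; linarith
  have h4 : ‖q‖ ^ 2 ≤ (N + ‖q‖) ^ 2 := by gcongr; linarith
  have h5 : c * (Cφ * N ^ 2) * (K + 1) ≤ Cφ * (K + 1) * (c * (N + ‖q‖) ^ 2) := by
    calc c * (Cφ * N ^ 2) * (K + 1) = Cφ * (K + 1) * (c * N ^ 2) := by ring
      _ ≤ _ := by gcongr
  have h6 : c * (2 / ψ 0) * ‖q‖ ^ 2 * (K + 1) ≤ 2 / ψ 0 * (K + 1) * (c * (N + ‖q‖) ^ 2) := by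
    calc c * (2 / ψ 0) * ‖q‖ ^ 2 * (K + 1) = 2 / ψ 0 * (K + 1) * (c * ‖q‖ ^ 2) := by ring
      _ ≤ _ := by gcongr
  have h7 : 0 ≤ (Cφ * (K + 1) + 2 / ψ 0 * (K + 1)) * (N + ‖q‖) := by positivity
  have h8 : 0 ≤ c * (N + ‖q‖) ^ 2 := by positivity
  linarith

/-- Ω need not be open, since the domain of φ may be a closed interval; smallness of F keeps ‖F‖²
away from its right endpoint. -/
theorem Omega_mem_nhds {F : X → H} {g : Fin m → X → ℝ} {φ : ℝ≥0 → ℝ≥0∞} {ψ : Rm m → ℝ}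
    (hψ : IsBarrierFun ψ) (hF : Differentiable ℝ F) (hg : ∀ i, Differentiable ℝ (g i)) {x : X}
    (hx : x ∈ Omega F g φ ψ) {τ : ℝ} (hτ : ∀ t, 0 ≤ t → t ≤ τ → t ∈ phiDom φ)
    (hFx : ‖F x‖ ^ 2 < τ) : Omega F g φ ψ ∈ 𝓝 x := by
  obtain ⟨_, -, -, hbd⟩ := hasFDerivAt_bFun hψ (x := x) (fun i => hg i x)
  have h1 := hbd.continuousAt.eventually (lt_mem_nhds hx.1)
  have h2 := ((hF x).continuousAt.norm.pow 2).eventually (gt_mem_nhds hFx)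
  filter_upwards [h1, h2] with y hy1 hy2
  exact ⟨hy1, (phi_lt_top_iff F y).2 (hτ _ (by positivity) hy2.le)⟩

theorem differentiableAt_fderiv_of_contDiffOn {Y : Type*} [NormedAddCommGroup Y] [NormedSpace ℝ Y] {G : X → Y}
    {s : Set X} {x : X} (hG : ContDiffOn ℝ 2 G s) (hs : s ∈ 𝓝 x) :
    DifferentiableAt ℝ (fderiv ℝ G) x :=
  ((hG.contDiffAt hs).fderiv_right (m := 1) (by norm_num)).differentiableAt one_ne_zero

/-- Bound for the remainder in the stationarity condition with respect to `x`. -/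
theorem norm_primal_remainder_le {f : X → ℝ} {F : X → H} {g : Fin m → X → ℝ} {φ : ℝ≥0 → ℝ≥0∞}
    {ψ : Rm m → ℝ} (hψ : IsBarrierFun ψ) (hφ1 : ContDiffOn ℝ 1 (phiReal φ) (phiDom φ))
    (hf : Differentiable ℝ f) (hF : Differentiable ℝ F) (hg : ∀ i, Differentiable ℝ (g i))
    {c : ℝ} (hc : 0 < c) {x : X} {lam : H} {mu : Rm m} (hΩ : Omega F g φ ψ ∈ 𝓝 x)
    (hmin : ∀ y ∈ Omega F g φ ψ,
      augLagrangianReal f F g φ ψ c x lam mu ≤ augLagrangianReal f F g φ ψ c y lam mu)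
    {B K Cψ : ℝ} (hB : 0 ≤ B) (hK : 0 ≤ K) (hCψ : 0 ≤ Cψ)
    (hf2 : DifferentiableAt ℝ (fderiv ℝ f) x)
    (hf1B : ‖fderiv ℝ f x‖ ≤ B) (hf2B : ‖fderiv ℝ (fderiv ℝ f) x‖ ≤ B)
    {J' : X →L[ℝ] X →L[ℝ] Mult H m} (hJ : HasFDerivAt (jac F g) J' x)
    (hJB : ‖jac F g x‖ ≤ B) (hJ'B : ‖J'‖ ≤ B)
    (hgB : ∀ i, |g i x| ≤ B) (hg1B : ∀ i, ‖fderiv ℝ (g i) x‖ ≤ B)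
    (hz : ‖mult lam mu‖ ^ 2 ≤ K) (hb : ψ 0 / 2 ≤ bFun g ψ x)
    (hψ' : ‖fderivWithin ℝ ψ (orthant m) (gPlus g x)‖ ≤ Cψ) :
    ‖gradLagrangian f F g x lam mu
        + c • ContinuousLinearMap.adjoint (jac F g x) (penVec F g φ ψ c x lam mu)‖ ≤
      (2 * (1 + K) / ψ 0 ^ 2 * (Cψ * B)) * (c * ‖qVec g ψ x mu c‖ ^ 2) +
      (2 * B * (B + (K + 1) * B) + m * (2 * B * B * (K + 1)))
        * ‖kktRes f F g x (mult lam mu)‖ := by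
  have hψ0 := hψ.pos
  have hb0 : 0 < bFun g ψ x := by linarith
  have hzK : ‖mult lam mu‖ ≤ K + 1 := by nlinarith [norm_nonneg (mult lam mu)]
  obtain ⟨A', hA', hA'B⟩ := exists_hasFDerivAt_kktRes (mult lam mu) hB hf2 hf1B hf2B hJ hJB hJ'B
    (fun i => hg i x) hgB hg1B
  obtain ⟨η', hη', hη'B⟩ := exists_hasFDerivAt_eta hf hF hg lam mu hA' hA'B
  have hst := stationary_primal hψ hφ1 hf hF hg hc hΩ hmin hη'
  set e := gradLagrangian f F g x lam mu
        + c • ContinuousLinearMap.adjoint (jac F g x) (penVec F g φ ψ c x lam mu)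
  set q := qVec g ψ x mu c
  set α := ‖kktRes f F g x (mult lam mu)‖ with hα
  have hα0 : 0 ≤ α := norm_nonneg _
  have hμ : ‖mu‖ ^ 2 ≤ K := by
    have h1 := norm_mult_sq lam mu
    nlinarith [sq_nonneg ‖lam‖]
  have hcoef : c * (1 + ‖mu‖ ^ 2) / (2 * bFun g ψ x ^ 2) ≤ c * (2 * (1 + K) / ψ 0 ^ 2) := by
    calc c * (1 + ‖mu‖ ^ 2) / (2 * bFun g ψ x ^ 2) ≤ c * (1 + K) / (2 * (ψ 0 / 2) ^ 2) := by gcongr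
      _ = _ := by field_simp
  have hgrad : ‖gradG g x e‖ ≤ B * ‖e‖ := by
    have h1 := norm_snd_le (fderiv ℝ F x e) (gradG g x e)
    rw [← jac_apply (hF x) (fun i => hg i x)] at h1
    exact h1.trans (ContinuousLinearMap.le_of_opNorm_le _ hJB e)
  have hDb : |fderivWithin ℝ ψ (orthant m) (gPlus g x) (gradG g x e)| ≤ Cψ * (B * ‖e‖) := by
    refine (ContinuousLinearMap.le_of_opNorm_le _ hψ' _).trans ?_
    gcongr
  have h1 : c * (1 + ‖mu‖ ^ 2) / (2 * bFun g ψ x ^ 2) * ‖q‖ ^ 2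
        * fderivWithin ℝ ψ (orthant m) (gPlus g x) (gradG g x e) ≤
      c * (2 * (1 + K) / ψ 0 ^ 2) * ‖q‖ ^ 2 * (Cψ * (B * ‖e‖)) := by
    calc _ ≤ c * (1 + ‖mu‖ ^ 2) / (2 * bFun g ψ x ^ 2) * ‖q‖ ^ 2 * (Cψ * (B * ‖e‖)) := by
          gcongr
          exact (le_abs_self _).trans hDb
      _ ≤ _ := by gcongr
  have h2 : -η' e ≤ α * ((2 * B * (B + (K + 1) * B) + m * (2 * B * B * (K + 1))) * ‖e‖) := by
    refine (neg_le_abs _).trans ((hη'B e).trans ?_)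
    gcongr
  -- Testing stationarity in the direction e itself bounds ‖e‖² by a multiple of ‖e‖.
  have h3 := hst e
  rw [real_inner_self_eq_norm_sq] at h3
  have h4 : ‖e‖ * ‖e‖ ≤ ((2 * (1 + K) / ψ 0 ^ 2 * (Cψ * B)) * (c * ‖q‖ ^ 2) +
      (2 * B * (B + (K + 1) * B) + m * (2 * B * B * (K + 1))) * α) * ‖e‖ := by
    linarith
  rcases (norm_nonneg e).eq_or_lt with h0 | h0
  · rw [← h0]
    positivity
  · exact le_of_mul_le_mul_right h4 h0

/-! ### Minimisers are KKT-points, and global exactness -/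

/-- For large `c` every global minimiser of the augmented Lagrangian whose value does not exceed
the optimal value of the problem is a KKT-point. -/
theorem exists_forall_minimiser_isKKT {f : X → ℝ} {F : X → H} {g : Fin m → X → ℝ}
    {φ : ℝ≥0 → ℝ≥0∞} {ψ : Rm m → ℝ} (hφ : IsPenaltyFun φ) (hψ : IsBarrierFun ψ)
    (hf : Differentiable ℝ f) (hF : Differentiable ℝ F) (hg : ∀ i, Differentiable ℝ (g i))
    (hf2 : ContDiffOn ℝ 2 f (Omega F g φ ψ)) (hF2 : ContDiffOn ℝ 2 F (Omega F g φ ψ))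
    (hg2 : ∀ i, ContDiffOn ℝ 2 (g i) (Omega F g φ ψ))
    (hφ1 : ContDiffOn ℝ 1 (phiReal φ) (phiDom φ))
    (hφ0 : 0 < derivWithin (phiReal φ) (phiDom φ) 0) {V : Set X}
    (hfB : BoundedC2On f V) (hFB : BoundedC2On F V) (hgB : ∀ i, BoundedC2On (g i) V)
    {a : ℝ} (ha : 0 < a) (hQ : ∀ x ∈ V, ∀ (lam : H) (mu : Rm m),
      a * (‖lam‖ ^ 2 + ‖mu‖ ^ 2) ≤ quadQ F g x lam mu) {K : ℝ} (hK : 0 < K) :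
    ∃ c₁ : ℝ, 0 < c₁ ∧ ∀ c, c₁ ≤ c → ∀ (x : X) (lam : H) (mu : Rm m), x ∈ Omega F g φ ψ → x ∈ V →
      ‖mult lam mu‖ ^ 2 ≤ K → ‖kktRes f F g x (mult lam mu)‖ ^ 2 ≤ K →
      c * ‖F x‖ ^ 2 ≤ K → c * ‖qVec g ψ x mu c‖ ^ 2 ≤ K →
      (∀ y ∈ Omega F g φ ψ, ∀ (l : H) (u : Rm m),
        augLagrangianReal f F g φ ψ c x lam mu ≤ augLagrangianReal f F g φ ψ c y l u) →
      IsKKT f F g x lam mu := by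
  have hψ0 := hψ.pos
  set κ := derivWithin (phiReal φ) (phiDom φ) 0 with hκ
  obtain ⟨B₁, hB₁, hJ⟩ := exists_jac_bound hF hg hFB hgB
  obtain ⟨B₂, hB₂⟩ := hfB
  set B := max B₁ B₂ with hBdef
  have hB : 0 < B := lt_max_of_lt_left hB₁
  obtain ⟨τ, Cφ, hτ, hCφ, hφb⟩ := exists_phiReal_le hφ hφ1
  obtain ⟨δ, Cψ, hδ, hCψ, hψb⟩ := exists_barrier_bound hψ
  set C₁ := 2 * (1 + K) / ψ 0 ^ 2 * (Cψ * B)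
  set C₂ := 2 * B * (B + (K + 1) * B) + m * (2 * B * B * (K + 1))
  have hC₁ : 0 ≤ C₁ := by positivity
  have hC₂ : 0 ≤ C₂ := by positivity
  obtain ⟨c₁, hc₁, hthr⟩ := exists_threshold (s := √(2 * a)) (K := K)
    (K₁ := B * C₁ * ψ 0 + B * C₂ + 1 + (K + 1) * (ψ 0 + 1))
    (K₂ := 1 + Cφ * (K + 1) + 2 / ψ 0 * (K + 1)) (K₃ := 1 / κ + ψ 0)
    (by positivity) hK (by positivity) (by positivity) (by positivity)
  -- The summands ensure, in turn, the threshold estimate, c ≥ 1, |max{g, 0}| ≤ δ, and ‖F‖² < τ,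
  -- where the factor 2 makes the inequality strict.
  refine ⟨c₁ + 1 + K / δ ^ 2 + 2 * K / τ, by positivity, ?_⟩
  intro c hc x lam mu hx hxV hz hA hFc hqc hmin
  have hKδ : 0 < K / δ ^ 2 := by positivity
  have hKτ : 0 < 2 * K / τ := by positivity
  have hc1 : 1 ≤ c := by linarith
  have hc0 : 0 < c := by linarith
  have hb0 := hx.1
  have hFτ : ‖F x‖ ^ 2 < τ := by
    have h1 : 2 * K / τ ≤ c := by linarith
    rw [div_le_iff₀ hτ] at h1
    have h2 : c * ‖F x‖ ^ 2 < c * τ := by linarith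
    exact lt_of_mul_lt_mul_left h2 hc0.le
  have hgδ : ‖gPlus g x‖ ≤ δ := by
    refine (norm_gPlus_le_norm_qVec g ψ x mu c).trans ?_
    refine abs_le_of_sq_le_sq' ?_ hδ.le |>.2
    have h1 : K / δ ^ 2 ≤ c := by linarith
    rw [div_le_iff₀ (by positivity)] at h1
    have h2 : c * ‖qVec g ψ x mu c‖ ^ 2 ≤ c * δ ^ 2 := by linarith
    exact le_of_mul_le_mul_left h2 hc0
  obtain ⟨hbl, hψ'⟩ := hψb (gPlus g x) (posPart_mem (gVec g x)) hgδ
  have hΩ := Omega_mem_nhds hψ hF hg hx (fun t h0 h1 => (hφb t h0 h1).1) hFτ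
  obtain ⟨hJ1, hJ2, hJ3, hJ4⟩ := hJ x hxV
  obtain ⟨J', hJ', hJ'B⟩ := hJ4 (differentiableAt_fderiv_of_contDiffOn hF2 hΩ)
    fun i => differentiableAt_fderiv_of_contDiffOn (hg2 i) hΩ
  have hB₁B : B₁ ≤ B := le_max_left _ _
  have hB₂B : B₂ ≤ B := le_max_right _ _
  have he := norm_primal_remainder_le hψ hφ1 hf hF hg hc0 hΩ (fun y hy => hmin y hy lam mu)
    hB.le hK.le hCψ.le (differentiableAt_fderiv_of_contDiffOn hf2 hΩ) ((hB₂ x hxV).2.1.trans hB₂B)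
    ((hB₂ x hxV).2.2.trans hB₂B) hJ' (hJ1.trans hB₁B) (hJ'B.trans hB₁B)
    (fun i => (hJ2 i).trans hB₁B) (fun i => (hJ3 i).trans hB₁B) hz hbl hψ'
  have hprimal := primal_estimate hψ hf hF hg hc1 hK.le ha (hQ x hxV) hb0 (hJ1.trans hB₁B) hz hqc
    he hC₁ hC₂
  have hdual := dual_estimate hψ hF hg hc0 hK.le ha (hQ x hxV) hbl hz hCφ.le
    (hφb _ (by positivity) hFτ.le).2
    (stationary_dual hf hF hg hc0 hx fun l u => hmin x hx l u)
  have hF1 : ‖F x‖ ≤ 1 / κ * ‖penVec F g φ ψ c x lam mu‖ :=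
    norm_fst_penVec hφ0 (deriv_zero_le_deriv_phiReal hφ hφ1 ((phi_lt_top_iff F x).1 hx.2))
  have hq1 : ‖qVec g ψ x mu c‖ ≤ ψ 0 * ‖penVec F g φ ψ c x lam mu‖ := norm_qVec_le_penVec hψ hb0
  obtain ⟨hA0, hY0⟩ := hthr c (by linarith) _ _ (‖F x‖ + ‖qVec g ψ x mu c‖) _ (norm_nonneg _)
    (norm_nonneg _) (by positivity) (norm_nonneg _) hqc hA hprimal
    (by rw [add_mul]; exact add_le_add hF1 hq1) hdual
  rw [hY0, mul_zero] at hF1 hq1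
  have hF0 : F x = 0 := norm_le_zero_iff.1 hF1
  have hq0 : qVec g ψ x mu c = 0 := norm_le_zero_iff.1 hq1
  refine ⟨?_, hF0, (qVec_eq_zero_iff hb0 hc0).1 hq0⟩
  -- With A, q and y zero, the bound on the remainder e becomes ‖∇L‖ ≤ 0.
  rw [hA0, hq0, norm_eq_zero.1 hY0, map_zero, smul_zero, add_zero, norm_zero] at he
  exact norm_le_zero_iff.1 (by simpa using he)

end ExactAL

end

theorem mainTheorem2 {X H : Type*}
    [NormedAddCommGroup X] [InnerProductSpace ℝ X] [CompleteSpace X]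
    [NormedAddCommGroup H] [InnerProductSpace ℝ H] [CompleteSpace H] {m : ℕ}
    (f : X → ℝ) (F : X → H) (g : Fin m → X → ℝ)
    (φ : ℝ≥0 → ℝ≥0∞) (ψ : ExactAL.Rm m → ℝ)
    -- standing assumptions
    (hφ : ExactAL.IsPenaltyFun φ) (hψ : ExactAL.IsBarrierFun ψ)
    (hf1 : ContDiff ℝ 1 f) (hF1 : ContDiff ℝ 1 F) (hg1 : ∀ i, ContDiff ℝ 1 (g i))
    -- the constrained problem has a globally optimal solution, and `fstar` is its optimal value
    (fstar : ℝ) (hfstar : IsLeast (f '' ExactAL.feasibleSet F g) fstar)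
    -- smoothness of the data on `Ω`, smoothness of `φ` on its effective domain, `φ'(0) > 0`
    (hf2 : ContDiffOn ℝ 2 f (ExactAL.Omega F g φ ψ))
    (hF2 : ContDiffOn ℝ 2 F (ExactAL.Omega F g φ ψ))
    (hg2 : ∀ i, ContDiffOn ℝ 2 (g i) (ExactAL.Omega F g φ ψ))
    (hφ1 : ContDiffOn ℝ 1 (ExactAL.phiReal φ) (ExactAL.phiDom φ))
    (hφ0 : 0 < derivWithin (ExactAL.phiReal φ) (ExactAL.phiDom φ) 0)
    -- weak sequential lower semicontinuity in `(x, λ, μ)`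
    (hlsc : ∀ c : ℝ, 0 < c → ExactAL.WeaklySeqLSC (ExactAL.augLagrangian f F g φ ψ c))
    -- assumptions on `Ω_r(f_* + ε)`
    (r ε : ℝ) (hr : 0 < r) (hε : 0 < ε)
    (hbdd : Bornology.IsBounded (ExactAL.OmegaSub f F g φ ψ r (fstar + ε)))
    (hfB : ExactAL.BoundedC2On f (ExactAL.OmegaSub f F g φ ψ r (fstar + ε)))
    (hFB : ExactAL.BoundedC2On F (ExactAL.OmegaSub f F g φ ψ r (fstar + ε)))
    (hgB : ∀ i, ExactAL.BoundedC2On (g i) (ExactAL.OmegaSub f F g φ ψ r (fstar + ε)))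
    (a : ℝ) (ha : 0 < a)
    (hQ : ∀ x ∈ ExactAL.OmegaSub f F g φ ψ r (fstar + ε), ∀ (lam : H) (mu : ExactAL.Rm m),
      a * (‖lam‖ ^ 2 + ‖mu‖ ^ 2) ≤ ExactAL.quadQ F g x lam mu) :
    ExactAL.IsGloballyExact f F g φ ψ := by
  have hf := hf1.differentiable one_ne_zero
  have hF := hF1.differentiable one_ne_zero
  have hg := fun i => (hg1 i).differentiable one_ne_zero
  obtain ⟨⟨x₀, hx₀, hfx₀⟩, hlb⟩ := hfstar
  have hsol : ExactAL.IsGlobalSolution f F g x₀ :=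
    ⟨hx₀, fun y hy => hfx₀.trans_le (hlb ⟨y, hy, rfl⟩)⟩
  have hgp : ExactAL.gPlus g x₀ = 0 := by
    ext i
    simpa [ExactAL.gPlus] using hx₀.2 i
  have hx₀V : x₀ ∈ ExactAL.OmegaSub f F g φ ψ r (fstar + ε) := by
    refine ⟨⟨?_, ?_⟩, ?_⟩
    · rw [ExactAL.bFun, hgp]
      exact hψ.pos
    · simp [hx₀.1, (hφ.eq_zero_iff 0).2 rfl]
    · rw [hx₀.1, hgp, hfx₀]
      simpa using hε.le
  obtain ⟨lam₀, mu₀, hkkt₀⟩ := ExactAL.exists_isKKT hf1 hF1 hg1 hsol ha (hQ x₀ hx₀V)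
  obtain ⟨c₀, K, hc₀, hK, hsub⟩ := ExactAL.exists_sublevel_bound hψ hf hF hg hφ0
    (fun t ht => ExactAL.deriv_zero_mul_le_phiReal hφ hφ1 ht) hε hfB hFB hgB ha hQ
  obtain ⟨c₁, hc₁, hstat⟩ := ExactAL.exists_forall_minimiser_isKKT hφ hψ hf hF hg hf2 hF2 hg2 hφ1
    hφ0 hfB hFB hgB ha hQ hK
  refine ⟨max c₀ c₁, lt_max_of_lt_left hc₀, fun c hc => ?_⟩
  have hcc₀ : c₀ ≤ c := (le_max_left _ _).trans hc
  have hcc₁ : c₁ ≤ c := (le_max_right _ _).trans hc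
  have hcpos : 0 < c := hc₀.trans_le hcc₀
  have hval : ∀ {x lam mu}, ExactAL.IsKKT f F g x lam mu →
      ExactAL.augLagrangian f F g φ ψ c (x, lam, mu) = (f x : EReal) :=
    fun h => h.augLagrangian_eq hφ hψ hcpos
  have hval₀ : ExactAL.augLagrangian f F g φ ψ c (x₀, lam₀, mu₀) = (fstar : EReal) := by
    rw [hval hkkt₀, hfx₀]
  have hdom : ∀ z : X × H × ExactAL.Rm m, ExactAL.augLagrangian f F g φ ψ c z ≤ (fstar : EReal) →
      z.1 ∈ ExactAL.Omega F g φ ψ ∧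
        ExactAL.augLagrangianReal f F g φ ψ c z.1 z.2.1 z.2.2 ≤ fstar := by
    intro z hz
    rw [ExactAL.augLagrangian] at hz
    split_ifs at hz with h
    · exact ⟨h, EReal.coe_le_coe_iff.1 hz⟩
    · exact absurd (top_le_iff.1 hz) (EReal.coe_ne_top _)
  have hforward : ∀ (x : X) (lam : H) (mu : ExactAL.Rm m),
      (∀ z : X × H × ExactAL.Rm m, ExactAL.augLagrangian f F g φ ψ c (x, lam, mu) ≤
        ExactAL.augLagrangian f F g φ ψ c z) →
      ExactAL.IsGlobalSolution f F g x ∧ ExactAL.IsKKT f F g x lam mu := by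
    intro x lam mu hmin
    have hle := hmin (x₀, lam₀, mu₀)
    rw [hval₀] at hle
    obtain ⟨hxΩ, hreal⟩ := hdom _ hle
    obtain ⟨hV, h1, h2, h3, h4⟩ := hsub c hcc₀ x hxΩ lam mu hreal
    have hkkt : ExactAL.IsKKT f F g x lam mu := by
      refine hstat c hcc₁ x lam mu hxΩ hV h1 h2 h3 h4 fun y hy l u => ?_
      have h5 := hmin (y, l, u)
      rw [ExactAL.augLagrangian, if_pos hxΩ, ExactAL.augLagrangian, if_pos hy] at h5
      exact EReal.coe_le_coe_iff.1 h5
    rw [hval hkkt] at hle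
    have hfx : f x ≤ fstar := EReal.coe_le_coe_iff.1 hle
    exact ⟨⟨⟨hkkt.2.1, fun i => hkkt.2.2 i ▸ le_max_left _ _⟩,
      fun y hy => hfx.trans (hlb ⟨y, hy, rfl⟩)⟩, hkkt⟩
  intro x lam mu
  refine ⟨hforward x lam mu, fun ⟨hxs, hxk⟩ z => ?_⟩
  -- A minimiser `w` exists because the sublevel set of f_* is bounded in all three variables. By
  -- the forward direction its value is f at a global solution, and the given KKT-point has the same
  -- value.
  obtain ⟨R, hR⟩ := hbdd.exists_norm_le
  obtain ⟨w, hw⟩ := ExactAL.exists_minimiser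
    (((WithLp.prodContinuousLinearEquiv 2 ℝ X (WithLp 2 (H × ExactAL.Rm m))).trans
      ((ContinuousLinearEquiv.refl ℝ X).prodCongr
        (WithLp.prodContinuousLinearEquiv 2 ℝ H (ExactAL.Rm m)))))
    (ExactAL.augLagrangian f F g φ ψ c) (hlsc c hcpos) (x₀, lam₀, mu₀) (max R (K + 1))
    (fun z hz => by
      rw [hval₀] at hz
      obtain ⟨hzΩ, hzr⟩ := hdom z hz
      obtain ⟨hV, h1, -⟩ := hsub c hcc₀ z.1 hzΩ z.2.1 z.2.2 hzr
      have h2 : ‖ExactAL.mult z.2.1 z.2.2‖ ≤ K + 1 := by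
        nlinarith [norm_nonneg (ExactAL.mult z.2.1 z.2.2)]
      exact norm_prod_le_iff.2 ⟨(hR _ hV).trans (le_max_left _ _), norm_prod_le_iff.2
        ⟨((ExactAL.norm_fst_le _ _).trans h2).trans (le_max_right _ _),
          ((ExactAL.norm_snd_le _ _).trans h2).trans (le_max_right _ _)⟩⟩)
  obtain ⟨hws, hwk⟩ := hforward w.1 w.2.1 w.2.2 hw
  rw [hval hxk]
  refine le_trans ?_ (hw z)
  have hwv : ExactAL.augLagrangian f F g φ ψ c w = (f w.1 : EReal) := hval hwk
  rw [hwv]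
  exact EReal.coe_le_coe_iff.2 (hxs.2 _ hws.1)
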